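/- Let $B$ be a unital algebra over $\mathbb{C}$. A *$B$-$B$-non-commutative probability space* is a triple $(\mathcal{A},E,\varepsilon)$, where $\mathcal{A}$ is a unital $\mathbb{C}$-algebra, $\varepsilon:B\otimes B^{\mathrm{op}}\to\mathcal{A}$ is a unital homomorphism that is injective on $B\otimes 1_B$ and on $1_B\otimes B^{\mathrm{op}}$, and $E:\mathcal{A}\to B$ is a linear map with $E(1_{\mathcal{A}})=1_B$ such that, writing $L_b=\varepsilon(b\otimes 1_B)$ and $R_b=\varepsilon(1_B\otimes b)$, $$E(L_{b_1}R_{b_2}T)=b_1E(T)b_2,\qquad E(TL_b)=E(TR_b)\qquad (b,b_1,b_2\in B,\ T\in\mathcal{A}).$$ Let $\mathcal{A}_\ell=\{T\in\mathcal A: TR_b=R_bT\ \forall b\in B\}$ and $\mathcal{A}_r=\{T\in\mathcal A: TL_b=L_bT\ \forall b\in B\}$. For $\chi:\{1,\dots,n\}\to\{\ell,r\}$ let $\prec_\chi$ be the total order on $\{1,\dots,n\}$ that lists the elements of $\chi^{-1}(\ell)$ in increasing order, followed by the elements of $\chi^{-1}(r)$ in decreasing order. Let $BNC(\chi)$ be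 the set of partitions $\pi$ of $\{1,\dots,n\}$ that are non-crossing with respect to $\prec_\chi$, ordered by refinement, let $1_\chi$ be its maximal element (the one-block partition), and let $\mu_{BNC}$ be its Möbius function. For $\pi\in BNC(\chi)$ and $T_1,\dots,T_n\in\mathcal A$ define $E_\pi(T_1,\dots,T_n)\in B$ recursively. If $\pi$ has a single block, then $E_\pi(T_1,\dots,T_n)=E(T_1\cdots T_n)$. Otherwise let $V$ be the block of $\pi$ whose minimum $m=\min V$ is largest, and let $X=L_{c}$ if $\chi(m)=\ell$ and $X=R_{c}$ if $\chi(m)=r$, where $c=E\big(\prod_{i\in V}T_i\big)$ with the product taken in increasing order of indices. * If no $j\notin V$ satisfies $j>m$, let $k=\max V^c$ and replace $T_k$ by $T_kX$. * Otherwise let $j_0$ be the $\prec_\chi$-least (if $\chi(m)=\ell$), respectively $\prec_\chi$-greatest (if $\chi(m)=r$), element of $\{j\notin V: j>m\}$, let $W$ be the block of $\pi$ containing $j_0$ (this is the block whose spine is adjacent to the node $m$ in the bi-non-crossing diagram of $\pi$), let $k$ be the smallest element of $W$ larger than $m$, and replace $T_k$ by $XT_k$. In both cases $E_\pi(T_1,\dots,T_n)$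 is the value of $E_{\pi|_{V^c}}$ at the resulting tuple restricted to $V^c$ (nodes keep their order and their sides). The *operator-valued bi-free cumulant function* is $$\kappa_\pi(T_1,\dots,T_n)=\sum_{\substack{\sigma\in BNC(\chi)\\ \sigma\le\pi}}E_\sigma(T_1,\dots,T_n)\,\mu_{BNC}(\sigma,\pi)\qquad (\pi\in BNC(\chi),\ T_k\in\mathcal A_{\chi(k)}).$$ **Proposition.** Let $(\mathcal{A},E,\varepsilon)$ be a $B$-$B$-non-commutative probability space, let $n\ge 2$, $\chi:\{1,\dots,n\}\to\{\ell,r\}$, and $T_k\in\mathcal{A}_{\chi(k)}$ for $1\le k\le n$. If there exist $q\in\{1,\dots,n\}$ and $b\in B$ such that $T_q=L_b$ if $\chi(q)=\ell$, or $T_q=R_b$ if $\chi(q)=r$, then $$\kappa_{1_\chi}(T_1,\dots,T_n)=0 .$$ -/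

import Mathlib

open scoped TensorProduct

namespace BiFree

/-- The two sides `ℓ` and `r`. -/
inductive Side : Type
  | left
  | right
  deriving DecidableEq

/-! ### Bi-non-crossing partitions -/

section Partitions

variable {n : ℕ}

/-- The position of the node `k` when the left nodes are read in increasing order, followed by the
right nodes in decreasing order. Left nodes get the values `0, …, n - 1` and right nodes the values
`n, …, 2n - 1`, so this is `s_χ⁻¹` up to a strictly increasing relabelling of its values. -/
def chiPos (χ : Fin n → Side) (k : Fin n) : ℕ :=
  if χ k = Side.left then (k : ℕ) else 2 * n - 1 - k

/-- The total order `≺_χ` on the nodes. -/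
def prec (χ : Fin n → Side) (a b : Fin n) : Prop := chiPos χ a < chiPos χ b

theorem prec_iff (χ : Fin n → Side) (a b : Fin n) :
    prec χ a b ↔
      (χ a = Side.left ∧ χ b = Side.left ∧ a < b) ∨
      (χ a = Side.left ∧ χ b = Side.right) ∨
      (χ a = Side.right ∧ χ b = Side.right ∧ b < a) := by
  have ha := a.isLt
  have hb := b.isLt
  unfold prec chiPos
  cases h1 : χ a <;> cases h2 : χ b <;> simp <;> omega

/-- A partition is bi-non-crossing with respect to `χ` if `u₁ ≺ v₁ ≺ u₂ ≺ v₂` with `u₁, u₂` in the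
block `U` and `v₁, v₂` in the block `V` forces `U = V`. -/
def IsBiNonCrossing (χ : Fin n → Side) (π : Finpartition (Finset.univ : Finset (Fin n))) : Prop :=
  ∀ U ∈ π.parts, ∀ V ∈ π.parts, ∀ u₁ ∈ U, ∀ u₂ ∈ U, ∀ v₁ ∈ V, ∀ v₂ ∈ V,
    prec χ u₁ v₁ → prec χ v₁ u₂ → prec χ u₂ v₂ → U = V

/-- `BNC(χ)`, ordered by refinement. -/
abbrev BNC (χ : Fin n → Side) : Type :=
  {π : Finpartition (Finset.univ : Finset (Fin n)) // IsBiNonCrossing χ π}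

/-- The maximal element `1_χ` of `BNC(χ)`. -/
def BNC.one (χ : Fin n → Side) : BNC χ :=
  ⟨⊤, fun _ hU _ hV _ _ _ _ _ _ _ _ _ _ _ =>
    Finpartition.parts_top_subsingleton _ hU hV⟩

noncomputable instance (χ : Fin n → Side) : Fintype (BNC χ) := Fintype.ofFinite _

open Classical in
noncomputable instance (χ : Fin n → Side) : LocallyFiniteOrder (BNC χ) :=
  Fintype.toLocallyFiniteOrder

open Classical in
/-- The Möbius function `μ_BNC` on `BNC(χ)`: the convolution inverse of the zeta function. -/
noncomputable def mobius (χ : Fin n → Side) : IncidenceAlgebra ℂ (BNC χ) :=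
  IncidenceAlgebra.mu ℂ

/-- The block of a nonempty collection of blocks whose minimum is largest. -/
noncomputable def lastBlock (π : Finset (Finset (Fin n))) (h : π.Nonempty) : Finset (Fin n) :=
  (π.exists_max_image (fun V => V.min) h).choose

theorem lastBlock_mem (π : Finset (Finset (Fin n))) (h : π.Nonempty) : lastBlock π h ∈ π :=
  (π.exists_max_image (fun V => V.min) h).choose_spec.1

/-- The first (`s = left`) or last (`s = right`) element of `D` with respect to `≺_χ`. -/
noncomputable def extremal (χ : Fin n → Side) (s : Side) (D : Finset (Fin n)) (h : D.Nonempty) :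
    Fin n :=
  match s with
  | Side.left => (D.exists_min_image (chiPos χ) h).choose
  | Side.right => (D.exists_max_image (chiPos χ) h).choose

theorem extremal_mem (χ : Fin n → Side) (s : Side) (D : Finset (Fin n)) (h : D.Nonempty) :
    extremal χ s D h ∈ D := by
  cases s
  · exact (D.exists_min_image (chiPos χ) h).choose_spec.1
  · exact (D.exists_max_image (chiPos χ) h).choose_spec.1

/-- The elements of `D` that lie in the same block of `π` as `j`. -/
def sameBlock (π : Finset (Finset (Fin n))) (D : Finset (Fin n)) (j : Fin n) : Finset (Fin n) :=
  D.filter fun i => ∃ W ∈ π, i ∈ W ∧ j ∈ W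

/-- The nodes of the blocks in `π` that lie strictly below the node `m`. -/
def below (π : Finset (Finset (Fin n))) (m : Fin n) : Finset (Fin n) :=
  (π.sup id).filter fun j => m < j

theorem sameBlock_extremal_nonempty (χ : Fin n → Side) (s : Side)
    (π : Finset (Finset (Fin n))) (m : Fin n) (h : (below π m).Nonempty) :
    (sameBlock π (below π m) (extremal χ s (below π m) h)).Nonempty := by
  have hj := extremal_mem χ s (below π m) h
  refine ⟨_, Finset.mem_filter.2 ⟨hj, ?_⟩⟩
  obtain ⟨W, hW, hjW⟩ := Finset.mem_sup.1 (Finset.mem_filter.1 hj).1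
  exact ⟨W, hW, hjW, hjW⟩

theorem sup_erase_nonempty (π : Finset (Finset (Fin n))) (hπ : ∀ V ∈ π, V.Nonempty)
    (h : 1 < π.card) (V : Finset (Fin n)) : ((π.erase V).sup id).Nonempty := by
  obtain ⟨W, hW, hWV⟩ := Finset.exists_mem_ne h V
  obtain ⟨i, hi⟩ := hπ W hW
  exact ⟨i, Finset.mem_sup.2 ⟨W, Finset.mem_erase.2 ⟨hWV, hW⟩, hi⟩⟩

/-- The product of the `T i`, `i ∈ S`, in increasing order of the indices. -/
def orderedProd {A : Type*} [Monoid A] (T : Fin n → A) (S : Finset (Fin n)) : A :=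
  ((S.sort (· ≤ ·)).map T).prod

end Partitions

/-! ### `B`-`B`-non-commutative probability spaces -/

/-- A `B`-`B`-non-commutative probability space `(A, E, ε)`. -/
structure BBSpace (B A : Type*) [Ring B] [Algebra ℂ B] [Ring A] [Algebra ℂ A] where
  /-- The unital homomorphism `ε : B ⊗ Bᵒᵖ → A`. -/
  ε : B ⊗[ℂ] Bᵐᵒᵖ →ₐ[ℂ] A
  /-- The expectation. -/
  E : A →ₗ[ℂ] B
  injective_left : Function.Injective fun b : B => ε (b ⊗ₜ[ℂ] 1)
  injective_right : Function.Injective fun b : B => ε (1 ⊗ₜ[ℂ] MulOpposite.op b)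
  E_one : E 1 = 1
  E_bimodule : ∀ (b₁ b₂ : B) (T : A), E (ε (b₁ ⊗ₜ[ℂ] MulOpposite.op b₂) * T) = b₁ * E T * b₂
  E_balanced : ∀ (b : B) (T : A),
    E (T * ε (b ⊗ₜ[ℂ] 1)) = E (T * ε (1 ⊗ₜ[ℂ] MulOpposite.op b))

namespace BBSpace

variable {B A : Type*} [Ring B] [Algebra ℂ B] [Ring A] [Algebra ℂ A] (P : BBSpace B A) {n : ℕ}

/-- `L_b = ε(b ⊗ 1)`. -/
def L (b : B) : A := P.ε (b ⊗ₜ[ℂ] 1)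

/-- `R_b = ε(1 ⊗ b)`. -/
def R (b : B) : A := P.ε (1 ⊗ₜ[ℂ] MulOpposite.op b)

/-- `L_b` on the left side, `R_b` on the right side. -/
def op (s : Side) (b : B) : A :=
  match s with
  | Side.left => P.L b
  | Side.right => P.R b

/-- The left algebra `A_ℓ` (the elements commuting with every `R_b`) and the right algebra `A_r`
(the elements commuting with every `L_b`). -/
def face (s : Side) : Subalgebra ℂ A :=
  match s with
  | Side.left => Subalgebra.centralizer ℂ (Set.range P.R)
  | Side.right => Subalgebra.centralizer ℂ (Set.range P.L)

/-- The recursive definition of `E_π(T_1, …, T_n)`; the collection `π` of blocks may cover only some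
of the nodes, and then only the `T_i` at covered nodes matter (this is the restriction to a union of
blocks).

Let `V` be the block with the largest minimum `m`, and `X = L_{E(T|_V)}` or `X = R_{E(T|_V)}`
according to the side of `m`. If no node outside `V` is below `m`, the last entry outside `V` is
multiplied by `X` on the right. Otherwise, by the choice of `V`, each node below `m` outside `V`
belongs to a block whose spine passes the level of `m`. The spines passing that level are ordered
from left to right as their nodes below `m` are ordered by `≺_χ`, so the spine adjacent to `m` is
that of the block `W` containing the first (`m` on the left) or the last (`m` on the right) of these
nodes; the entry at the first node of `W` below `m` is then multiplied by `X` on the left. -/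
noncomputable def momentAux (χ : Fin n → Side) (π : Finset (Finset (Fin n)))
    (hπ : ∀ V ∈ π, V.Nonempty) (T : Fin n → A) : B :=
  if h : 1 < π.card then
    let hne : π.Nonempty := Finset.card_pos.1 (by omega)
    let V := lastBlock π hne
    let m := V.min' (hπ V (lastBlock_mem π hne))
    let X := P.op (χ m) (P.E (orderedProd T V))
    have hπ' : ∀ U ∈ π.erase V, U.Nonempty := fun U hU => hπ U (Finset.mem_of_mem_erase hU)
    have hlt : (π.erase V).card < π.card := Finset.card_erase_lt_of_mem (lastBlock_mem π hne)
    if hD : (below (π.erase V) m).Nonempty then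
      let k := (sameBlock (π.erase V) (below (π.erase V) m)
        (extremal χ (χ m) (below (π.erase V) m) hD)).min'
          (sameBlock_extremal_nonempty χ (χ m) (π.erase V) m hD)
      momentAux χ (π.erase V) hπ' (Function.update T k (X * T k))
    else
      let k := ((π.erase V).sup id).max' (sup_erase_nonempty π hπ h V)
      momentAux χ (π.erase V) hπ' (Function.update T k (T k * X))
  else P.E (orderedProd T (π.sup id))
termination_by π.card

/-- The operator-valued bi-free moment function `ℰ_π(T_1, …, T_n)`. -/
noncomputable def moment (χ : Fin n → Side) (π : BNC χ) (T : ∀ k, P.face (χ k)) : B :=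
  P.momentAux χ π.1.parts (fun _ hV => π.1.nonempty_of_mem_parts hV) fun k => (T k : A)

open Classical in
/-- The operator-valued bi-free cumulant function `κ = ℰ * μ_BNC`, that is
`κ_π(T_1, …, T_n) = ∑_{σ ≤ π} ℰ_σ(T_1, …, T_n) μ_BNC(σ, π)`. -/
noncomputable def cumulant (χ : Fin n → Side) (π : BNC χ) (T : ∀ k, P.face (χ k)) : B :=
  ∑ σ : BNC χ with σ ≤ π, mobius χ σ π • P.moment χ σ T

end BBSpace

end BiFree

namespace BiFree

/-! ### Ordered products -/

section OrderedProd

variable {n : ℕ} {A : Type*} [Monoid A]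

/-! For a bi-non-crossing partition `σ`, let `σ'` be its meet with `{{q}, {q}ᶜ}`, so that `q`
becomes a block of its own. When `T q` is `L_b` or `R_b` on its own side, `σ` and `σ'` have the same
moment (`moment_isolate`). Grouping the cumulant sum by `σ'`, each moment is multiplied by the sum
of `μ(σ, 1)` over a fibre of `σ ↦ σ'`. Such a sum vanishes by Weisner's theorem
(`sum_mu_fiber_eq_zero`), because the one-block partition does not refine `{{q}, {q}ᶜ}` once `n ≥
2`.

The work lies in the equality of moments. The defining recursion always removes the block with the
largest minimum, which is too rigid for comparing `σ` with `σ'`. It is replaced by the evaluation of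
decorated words: each node `k` carries some `d k` in `B`, acting on the side of `k`, and a further
`e` in `B` sits in the middle, between the left and the right nodes for `≺_χ`. A block that is an
interval among the remaining nodes can be stripped; its value passes to the next node on the side of
its minimum, or to `e` if there is none.

Three facts carry the argument. The order of stripping is irrelevant (`strip_comm`,
`eval_eq_of_isInterval`). Stripping `W` has the same effect as stripping `{q}` and then `W \ {q}`
(`strip_split`). The recursion computes the value of the undecorated word (`momentAux_eq_eval`). All
three rest on two rules: an operator of one side commutes with the entries of the other side, and `E
(x L_c) = E (x R_c)`. -/

@[simp] theorem orderedProd_empty (T : Fin n → A) : orderedProd T ∅ = 1 := by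
  simp [orderedProd]

@[simp] theorem orderedProd_singleton (T : Fin n → A) (k : Fin n) : orderedProd T {k} = T k := by
  simp [orderedProd]

theorem orderedProd_congr {T T' : Fin n → A} {V : Finset (Fin n)} (h : ∀ k ∈ V, T k = T' k) :
    orderedProd T V = orderedProd T' V := by
  unfold orderedProd
  congr 1
  exact List.map_congr_left fun k hk => h k ((Finset.mem_sort _).1 hk)

theorem orderedProd_insert_min (T : Fin n → A) {a : Fin n} {V : Finset (Fin n)}
    (h : ∀ k ∈ V, a < k) : orderedProd T (insert a V) = T a * orderedProd T V := by
  unfold orderedProd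
  rw [Finset.sort_insert (· ≤ ·) (fun b hb => (h b hb).le) fun ha => lt_irrefl _ (h a ha)]
  simp

theorem orderedProd_union (T : Fin n → A) (U V : Finset (Fin n)) (h : ∀ u ∈ U, ∀ v ∈ V, u < v) :
    orderedProd T (U ∪ V) = orderedProd T U * orderedProd T V := by
  revert h
  refine Finset.induction_on_min U (by simp) fun a s hs ih h => ?_
  rw [Finset.insert_union, orderedProd_insert_min, orderedProd_insert_min T hs,
    ih fun u hu => h u (Finset.mem_insert_of_mem hu), mul_assoc]
  intro k hk
  rcases Finset.mem_union.1 hk with hk | hk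
  · exact hs k hk
  · exact h a (Finset.mem_insert_self _ _) k hk

theorem orderedProd_split (T : Fin n → A) (V : Finset (Fin n)) (t : Fin n) :
    orderedProd T V = orderedProd T (V.filter (· < t)) * orderedProd T (V.filter (t ≤ ·)) := by
  rw [← orderedProd_union]
  · congr 1
    ext k
    simp only [Finset.mem_union, Finset.mem_filter]
    rcases lt_or_ge k t with h | h <;> simp [h, not_le.2, not_lt.2]
  · intro u hu v hv
    exact (Finset.mem_filter.1 hu).2.trans_le (Finset.mem_filter.1 hv).2

theorem orderedProd_filter_le (T : Fin n → A) {V : Finset (Fin n)} {p : Fin n} (hp : p ∈ V) :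
    orderedProd T (V.filter (p ≤ ·)) = T p * orderedProd T (V.filter (p < ·)) := by
  rw [← orderedProd_insert_min]
  · congr 1
    ext k
    simp only [Finset.mem_insert, Finset.mem_filter, le_iff_eq_or_lt]
    constructor
    · rintro ⟨h, rfl | h'⟩
      · exact Or.inl rfl
      · exact Or.inr ⟨h, h'⟩
    · rintro (rfl | ⟨h, h'⟩)
      · exact ⟨hp, Or.inl rfl⟩
      · exact ⟨h, Or.inr h'⟩
  · intro k hk
    exact (Finset.mem_filter.1 hk).2

theorem orderedProd_split_at (T : Fin n → A) {V : Finset (Fin n)} {p : Fin n} (hp : p ∈ V) :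
    orderedProd T V =
      orderedProd T (V.filter (· < p)) * (T p * orderedProd T (V.filter (p < ·))) := by
  rw [orderedProd_split T V p, orderedProd_filter_le T hp]

theorem commute_orderedProd {x : A} {T : Fin n → A} {V : Finset (Fin n)}
    (h : ∀ k ∈ V, Commute x (T k)) : Commute x (orderedProd T V) := by
  refine Commute.list_prod_right _ _ fun y hy => ?_
  obtain ⟨k, hk, rfl⟩ := List.mem_map.1 hy
  exact h k ((Finset.mem_sort _).1 hk)

/-- A factor inserted at `p` can be pulled to the front, since it commutes with everything before
`p`. It is used with entries before `p` on the opposite side, or with none. -/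
theorem orderedProd_update_mul {x : A} {T : Fin n → A} {V : Finset (Fin n)} {p : Fin n}
    (hp : p ∈ V) (h : ∀ k ∈ V, k < p → Commute x (T k)) :
    orderedProd (Function.update T p (x * T p)) V = x * orderedProd T V := by
  rw [orderedProd_split_at _ hp, orderedProd_split_at T hp, Function.update_self,
    orderedProd_congr (T := Function.update T p (x * T p)) (T' := T),
    orderedProd_congr (T := Function.update T p (x * T p)) (T' := T)]
  · have := commute_orderedProd (x := x) (T := T) (V := V.filter (· < p)) fun k hk =>
      h k (Finset.mem_filter.1 hk).1 (Finset.mem_filter.1 hk).2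
    simp only [mul_assoc]
    rw [← mul_assoc, ← this.eq, mul_assoc]
  · intro k hk
    exact Function.update_of_ne (Finset.mem_filter.1 hk).2.ne' _ _
  · intro k hk
    exact Function.update_of_ne (Finset.mem_filter.1 hk).2.ne _ _

theorem orderedProd_erase_last {T : Fin n → A} {V : Finset (Fin n)} {q : Fin n}
    (hq : q ∈ V) (h : ∀ k ∈ V, q < k → Commute (T q) (T k)) :
    orderedProd T V = orderedProd T (V.erase q) * T q := by
  have h1 : (V.erase q).filter (q ≤ ·) = V.filter (q < ·) := by
    ext k; simp only [Finset.mem_filter, Finset.mem_erase]; grind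
  have h2 : (V.erase q).filter (· < q) = V.filter (· < q) := by
    ext k; simp only [Finset.mem_filter, Finset.mem_erase]; grind
  rw [orderedProd_split_at T hq, orderedProd_split T (V.erase q) q, mul_assoc, h1, h2]
  have := commute_orderedProd (x := T q) (T := T) (V := V.filter (q < ·)) fun k hk =>
      h k (Finset.mem_filter.1 hk).1 (Finset.mem_filter.1 hk).2
  rw [this.eq]

theorem orderedProd_erase_next {T : Fin n → A} {V : Finset (Fin n)} {p q : Fin n}
    (hq : q ∈ V) (hp : p ∈ V) (hqp : q < p)
    (h : ∀ k ∈ V, q < k → k < p → Commute (T q) (T k)) :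
    orderedProd T V = orderedProd (Function.update T p (T q * T p)) (V.erase q) := by
  rw [orderedProd_split_at T hq, orderedProd_split _ (V.erase q) q]
  have h1 : (V.erase q).filter (q ≤ ·) = V.filter (q < ·) := by
    ext k; simp only [Finset.mem_filter, Finset.mem_erase]; grind
  have h2 : (V.erase q).filter (· < q) = V.filter (· < q) := by
    ext k; simp only [Finset.mem_filter, Finset.mem_erase]; grind
  rw [h1, h2, orderedProd_update_mul (Finset.mem_filter.2 ⟨hp, hqp⟩)]
  · congr 1
    refine orderedProd_congr fun k hk => ?_
    exact (Function.update_of_ne ((Finset.mem_filter.1 hk).2.trans hqp).ne _ _).symm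
  · intro k hk
    exact h k (Finset.mem_filter.1 hk).1 (Finset.mem_filter.1 hk).2

end OrderedProd

/-! ### Sums of Möbius functions -/

open scoped Classical in
/-- A form of Weisner's theorem: if `c` is an interior operator of the form `x ↦ x ⊓ a` with
`a` not above `t`, then the fibres of `c` have vanishing Möbius sums. -/
theorem sum_mu_fiber_eq_zero {α : Type*} [PartialOrder α] [Fintype α] [LocallyFiniteOrder α]
    [DecidableEq α]
    (c : α → α) (t : α) (p : α → Prop) (hc : ∀ x y, x ≤ c y ↔ x ≤ y ∧ p x)
    (hle : ∀ x, x ≤ t) (ht : ¬ p t) (x : α) :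
    ∑ y : α with c y = x, (IncidenceAlgebra.mu ℂ) y t = 0 := by
  have hcp : ∀ y, p (c y) := fun y => ((hc _ _).1 le_rfl).2
  have key : ∀ k : ℕ, ∀ x, (Finset.univ.filter (x < ·)).card = k →
      ∑ y : α with c y = x, (IncidenceAlgebra.mu ℂ) y t = 0 := by
    intro k
    induction k using Nat.strong_induction_on with
    | _ k ih =>
      intro x hx
      by_cases hpx : p x
      -- The elements with `x ≤ c y` form the interval `[x, t]`, and `x ≠ t`, so their Möbius sum is
      -- zero. Splitting it along the fibres of `c`, those above some `z > x` vanish by induction,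
      -- which leaves the fibre of `x`.
      · have h1 : ∑ y : α with x ≤ c y, (IncidenceAlgebra.mu ℂ) y t = 0 := by
          have h2 : (Finset.univ.filter fun y => x ≤ c y) = Finset.Icc x t := by
            ext y
            simp [hc, hpx, hle]
          rw [h2, IncidenceAlgebra.sum_Icc_mu_left, if_neg]
          rintro rfl
          exact ht hpx
        have h3 : (Finset.univ.filter fun y => x ≤ c y) =
            (Finset.univ.filter (x ≤ ·)).biUnion fun z => Finset.univ.filter fun y => c y = z := by
          ext y; simp
        rw [h3, Finset.sum_biUnion] at h1
        · have hx' : (Finset.univ.filter (x ≤ ·)) = insert x (Finset.univ.filter (x < ·)) := by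
            ext z; simp [le_iff_eq_or_lt, eq_comm]
          rw [hx', Finset.sum_insert (by simp),
            Finset.sum_eq_zero (s := Finset.univ.filter (x < ·)), add_zero] at h1
          · exact h1
          · intro z hz
            have hz : x < z := by simpa using hz
            refine ih _ ?_ z rfl
            rw [← hx]
            refine Finset.card_lt_card ⟨fun w hw => ?_, fun h => ?_⟩
            · simp only [Finset.mem_filter, Finset.mem_univ, true_and] at hw ⊢
              exact hz.trans hw
            · have := h (Finset.mem_filter.2 ⟨Finset.mem_univ z, hz⟩)
              simp at this
        · intro a _ b _ hab
          refine Finset.disjoint_left.2 fun y hy hy' => hab ?_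
          simp only [Finset.mem_filter] at hy hy'
          exact hy.2.symm.trans hy'.2
      · refine Finset.sum_eq_zero fun y hy => absurd ?_ hpx
        simp only [Finset.mem_filter] at hy
        exact hy.2 ▸ hcp y
  exact key _ x rfl

/-! ### Sided multiplication -/

/-- Multiplication by `c` on the left or on the right, according to the side. -/
def mulS {B : Type*} [Mul B] (s : Side) (c d : B) : B :=
  match s with
  | Side.left => c * d
  | Side.right => d * c

theorem mulS_assoc {B : Type*} [Semigroup B] (s : Side) (a b c : B) :
    mulS s (mulS s a b) c = mulS s a (mulS s b c) := by
  cases s <;> simp [mulS, mul_assoc]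

theorem mulS_comm {B : Type*} [Semigroup B] {s t : Side} (h : s ≠ t) (a b c : B) :
    mulS s a (mulS t b c) = mulS t b (mulS s a c) := by
  cases s <;> cases t <;> simp [mulS, mul_assoc] at h ⊢

@[simp] theorem mulS_one {B : Type*} [Monoid B] (s : Side) (a : B) : mulS s a 1 = a := by
  cases s <;> simp [mulS]

namespace BBSpace

variable {B A : Type*} [Ring B] [Algebra ℂ B] [Ring A] [Algebra ℂ A] (P : BBSpace B A) {n : ℕ}

theorem L_one : P.L 1 = 1 := by
  rw [L, ← Algebra.TensorProduct.one_def, map_one]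

theorem R_one : P.R 1 = 1 := by
  rw [R, MulOpposite.op_one, ← Algebra.TensorProduct.one_def, map_one]

@[simp] theorem op_one (s : Side) : P.op s 1 = 1 := by
  cases s
  · exact P.L_one
  · exact P.R_one

/-- `R` reverses products and `mulS` does so too on the right side, so `op s` is multiplicative for
`mulS s` on both sides. -/
theorem op_mulS (s : Side) (c d : B) : P.op s (mulS s c d) = P.op s c * P.op s d := by
  cases s <;> simp [op, mulS, L, R, ← map_mul]

theorem commute_L_R (c d : B) : Commute (P.L c) (P.R d) := by
  simp [Commute, SemiconjBy, L, R, ← map_mul]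

theorem commute_op_op {s t : Side} (h : s ≠ t) (c d : B) : Commute (P.op s c) (P.op t d) := by
  cases s <;> cases t <;> simp only [ne_eq, not_true_eq_false] at h
  · exact P.commute_L_R c d
  · exact (P.commute_L_R d c).symm

theorem commute_op_face {s t : Side} (h : s ≠ t) (c : B) {x : A} (hx : x ∈ P.face t) :
    Commute (P.op s c) x := by
  cases s <;> cases t <;> simp only [ne_eq, not_true_eq_false] at h
  · exact Subalgebra.mem_centralizer_iff ℂ |>.1 hx _ ⟨c, rfl⟩
  · exact Subalgebra.mem_centralizer_iff ℂ |>.1 hx _ ⟨c, rfl⟩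

theorem E_op_mul (s : Side) (c : B) (x : A) : P.E (P.op s c * x) = mulS s c (P.E x) := by
  cases s
  · simpa [op, mulS, L] using P.E_bimodule c 1 x
  · simpa [op, mulS, R] using P.E_bimodule 1 c x

theorem E_mul_op (s : Side) (c : B) (x : A) : P.E (x * P.op s c) = P.E (x * P.L c) := by
  cases s
  · rfl
  · exact (P.E_balanced c x).symm

/-- An operator just before the middle element merges with it: on the right side, `R_c` first
commutes past `L_e` and then turns into `L_c` under `E`. -/
theorem E_mul_op_mul_L (s : Side) (c e : B) (x : A) :
    P.E (x * P.op s c * P.L e) = P.E (x * P.L (mulS s c e)) := by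
  cases s
  · rw [mul_assoc]
    exact congrArg (fun y => P.E (x * y)) (P.op_mulS Side.left c e).symm
  · have h := (P.commute_L_R e c).eq
    rw [mul_assoc]
    change P.E (x * (P.R c * P.L e)) = _
    rw [← h, ← mul_assoc]
    change P.E (x * P.L e * P.op Side.right c) = _
    rw [P.E_mul_op, mul_assoc]
    exact congrArg (fun y => P.E (x * y)) (P.op_mulS Side.left e c).symm

end BBSpace

/-! ### Intervals and the next node -/

section Intervals

variable {n : ℕ} (χ : Fin n → Side)

/-- A collection of nonempty, pairwise disjoint, bi-non-crossing blocks. -/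
structure IsBlocks (π : Finset (Finset (Fin n))) : Prop where
  nonempty : ∀ V ∈ π, V.Nonempty
  disjoint : ∀ U ∈ π, ∀ V ∈ π, ∀ i ∈ U, i ∈ V → U = V
  nonCrossing : ∀ U ∈ π, ∀ V ∈ π, ∀ u₁ ∈ U, ∀ u₂ ∈ U, ∀ v₁ ∈ V, ∀ v₂ ∈ V,
    prec χ u₁ v₁ → prec χ v₁ u₂ → prec χ u₂ v₂ → U = V

variable {χ}

theorem IsBlocks.erase {π : Finset (Finset (Fin n))} (h : IsBlocks χ π) (V : Finset (Fin n)) :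
    IsBlocks χ (π.erase V) where
  nonempty U hU := h.nonempty U (Finset.mem_of_mem_erase hU)
  disjoint U hU W hW := h.disjoint U (Finset.mem_of_mem_erase hU) W (Finset.mem_of_mem_erase hW)
  nonCrossing U hU W hW :=
    h.nonCrossing U (Finset.mem_of_mem_erase hU) W (Finset.mem_of_mem_erase hW)

theorem mem_nodes {π : Finset (Finset (Fin n))} {i : Fin n} :
    i ∈ π.sup id ↔ ∃ V ∈ π, i ∈ V := by
  simp [Finset.mem_sup]

theorem IsBlocks.nodes_erase {π : Finset (Finset (Fin n))} (h : IsBlocks χ π)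
    {V : Finset (Fin n)} (hV : V ∈ π) : (π.erase V).sup id = π.sup id \ V := by
  ext i
  simp only [mem_nodes, Finset.mem_sdiff, Finset.mem_erase]
  constructor
  · rintro ⟨U, ⟨hUV, hU⟩, hi⟩
    exact ⟨⟨U, hU, hi⟩, fun hi' => hUV (h.disjoint U hU V hV i hi hi')⟩
  · rintro ⟨⟨U, hU, hi⟩, hi'⟩
    exact ⟨U, ⟨fun e => hi' (e ▸ hi), hU⟩, hi⟩

variable (χ)

/-- The nodes of `V` are consecutive among the nodes of `S` for the order `≺_χ`. -/
structure IsInterval (S V : Finset (Fin n)) : Prop where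
  same : ∀ u ∈ V, ∀ w ∈ V, ∀ x ∈ S, χ u = χ x → χ w = χ x → u < x → x < w → x ∈ V
  opposite : ∀ u ∈ V, ∀ w ∈ V, ∀ x ∈ S, χ u = χ x → χ w ≠ χ x → u < x → x ∈ V

/-- `m` is the least node of `V`. -/
def IsMin (V : Finset (Fin n)) (m : Fin n) : Prop := m ∈ V ∧ ∀ v ∈ V, m ≤ v

/-- `p` is the first node of `S` outside `V` that comes after the least node of `V` and is on the
same side. -/
def IsNext (S V : Finset (Fin n)) (p : Fin n) : Prop :=
  p ∈ S ∧ p ∉ V ∧ ∃ m, IsMin V m ∧ χ p = χ m ∧ m < p ∧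
    ∀ x ∈ S, x ∉ V → χ x = χ m → m < x → p ≤ x

variable {χ}

theorem IsMin.eq {V : Finset (Fin n)} {a b : Fin n} (ha : IsMin V a) (hb : IsMin V b) : a = b :=
  le_antisymm (ha.2 _ hb.1) (hb.2 _ ha.1)

theorem exists_isMin {V : Finset (Fin n)} (h : V.Nonempty) : ∃ m, IsMin V m :=
  ⟨V.min' h, V.min'_mem h, fun v hv => V.min'_le v hv⟩

theorem IsNext.eq {S V : Finset (Fin n)} {p q : Fin n} (hp : IsNext χ S V p)
    (hq : IsNext χ S V q) : p = q := by
  obtain ⟨hpS, hpV, m, hm, hpm, hlt, hle⟩ := hp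
  obtain ⟨hqS, hqV, m', hm', hqm, hlt', hle'⟩ := hq
  obtain rfl := hm.eq hm'
  exact le_antisymm (hle q hqS hqV hqm hlt') (hle' p hpS hpV hpm hlt)

theorem exists_isNext {S V : Finset (Fin n)} {m x : Fin n} (hm : IsMin V m) (hx : x ∈ S)
    (hxV : x ∉ V) (hχ : χ x = χ m) (hlt : m < x) : ∃ p, IsNext χ S V p := by
  obtain ⟨p, hp⟩ := exists_isMin (V := S.filter fun y => y ∉ V ∧ χ y = χ m ∧ m < y)
    ⟨x, by simp [hx, hxV, hχ, hlt]⟩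
  have h1 := Finset.mem_filter.1 hp.1
  exact ⟨p, h1.1, h1.2.1, m, hm, h1.2.2.1, h1.2.2.2, fun y hy hyV hyχ hy' =>
    hp.2 y (Finset.mem_filter.2 ⟨hy, hyV, hyχ, hy'⟩)⟩

theorem IsInterval.mono {S S' V : Finset (Fin n)} (h : IsInterval χ S V) (hS : S' ⊆ S) :
    IsInterval χ S' V where
  same u hu w hw x hx := h.same u hu w hw x (hS hx)
  opposite u hu w hw x hx := h.opposite u hu w hw x (hS hx)

theorem IsInterval.of_prec {S V : Finset (Fin n)}
    (h : ∀ u ∈ V, ∀ w ∈ V, ∀ x ∈ S, prec χ u x → prec χ x w → x ∈ V) : IsInterval χ S V where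
  same u hu w hw x hx h1 h2 h3 h4 := by
    cases hs : χ x
    · exact h u hu w hw x hx (by simp_all [prec_iff]) (by simp_all [prec_iff])
    · exact h w hw u hu x hx (by simp_all [prec_iff]) (by simp_all [prec_iff])
  opposite u hu w hw x hx h1 h2 h3 := by
    cases hs : χ x <;> cases hw' : χ w
    · simp_all
    · exact h u hu w hw x hx (by simp_all [prec_iff]) (by simp_all [prec_iff])
    · exact h w hw u hu x hx (by simp_all [prec_iff]) (by simp_all [prec_iff])
    · simp_all

/-- Every node of an interval is on the side of its next node and precedes it. -/
theorem IsNext.forall_lt {S V : Finset (Fin n)} {p : Fin n} (hV : IsInterval χ S V)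
    (hp : IsNext χ S V p) : ∀ v ∈ V, χ v = χ p ∧ v < p := by
  obtain ⟨hpS, hpV, m, hm, hpm, hlt, hle⟩ := hp
  intro v hv
  have h1 : χ v = χ p := by
    by_contra h
    exact hpV (hV.opposite m hm.1 v hv p hpS hpm.symm h hlt)
  refine ⟨h1, lt_of_not_ge fun h => ?_⟩
  rcases h.eq_or_lt with rfl | h
  · exact hpV hv
  · exact hpV (hV.same m hm.1 v hv p hpS hpm.symm h1 hlt h)

theorem lastBlock_spec (π : Finset (Finset (Fin n))) (h : π.Nonempty) {U : Finset (Fin n)}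
    (hU : U ∈ π) {m : Fin n} (hm : IsMin (lastBlock π h) m) {u : Fin n} (hu : IsMin U u) :
    u ≤ m := by
  have := (π.exists_max_image (fun V => V.min) h).choose_spec.2 U hU
  change U.min ≤ (lastBlock π h).min at this
  have h1 : (lastBlock π h).min = m := by
    refine le_antisymm (Finset.min_le hm.1) (Finset.le_min fun a ha => ?_)
    exact WithTop.coe_le_coe.2 (hm.2 a ha)
  have h2 : U.min = u := by
    refine le_antisymm (Finset.min_le hu.1) (Finset.le_min fun a ha => ?_)
    exact WithTop.coe_le_coe.2 (hu.2 a ha)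
  rw [h1, h2] at this
  exact WithTop.coe_le_coe.1 this

/-- Every other block has a node `u` smaller than all nodes of the last block. Such a `u` lies
outside the `≺_χ`-hull of that block, before it if `u` is on the left and after it if on the right.
A node of the same block as `u` inside the hull would therefore produce a crossing. -/
theorem isInterval_lastBlock {π : Finset (Finset (Fin n))} (hπ : IsBlocks χ π) (h : π.Nonempty) :
    IsInterval χ (π.sup id) (lastBlock π h) := by
  have hV := lastBlock_mem π h
  obtain ⟨m, hm⟩ := exists_isMin (hπ.nonempty _ hV)
  refine IsInterval.of_prec fun v hv w hw x hx h1 h2 => ?_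
  obtain ⟨U, hU, hxU⟩ := mem_nodes.1 hx
  by_contra hxV
  have hUV : U ≠ lastBlock π h := fun e => hxV (e ▸ hxU)
  obtain ⟨u, hu⟩ := exists_isMin (hπ.nonempty _ hU)
  have hum : u < m := lt_of_le_of_ne (lastBlock_spec π h hU hm hu) fun e =>
    hUV (hπ.disjoint U hU _ hV u hu.1 (e ▸ hm.1))
  have huv := hum.trans_le (hm.2 v hv)
  have huw := hum.trans_le (hm.2 w hw)
  cases hs : χ u
  · refine hUV (hπ.nonCrossing U hU _ hV u hu.1 x hxU v hv w hw ?_ h1 h2)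
    cases hs' : χ v <;> simp_all [prec_iff]
  · refine hUV (hπ.nonCrossing _ hV U hU v hv w hw x hxU u hu.1 h1 h2 ?_).symm
    cases hs' : χ w <;> simp_all [prec_iff]

end Intervals

/-- Two decorated words on the nodes `S` agree. -/
def Agree {n : ℕ} {B : Type*} (S : Finset (Fin n)) (x y : (Fin n → B) × B) : Prop :=
  (∀ k ∈ S, x.1 k = y.1 k) ∧ x.2 = y.2

theorem Agree.mono {n : ℕ} {B : Type*} {S S' : Finset (Fin n)} (hS : S' ⊆ S) {x y : (Fin n → B) × B}
    (h : Agree S x y) : Agree S' x y :=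
  ⟨fun k hk => h.1 k (hS hk), h.2⟩

/-! ### Stripping intervals off a decorated word -/

namespace BBSpace

variable {B A : Type*} [Ring B] [Algebra ℂ B] [Ring A] [Algebra ℂ A] (P : BBSpace B A) {n : ℕ}
  (χ : Fin n → Side) (T : Fin n → A)

/-- The entry `T k` decorated with `d k` on its side. -/
def decorate (d : Fin n → B) (k : Fin n) : A := P.op (χ k) (d k) * T k

/-- The expectation of the decorated entries in `V`, with `e` placed between the left and the right
nodes. -/
noncomputable def blockVal (V : Finset (Fin n)) (d : Fin n → B) (e : B) : B :=
  P.E (orderedProd (P.decorate χ T d) V * P.L e)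

open Classical in
/-- Strip the interval `V` off a word with nodes `S`: its value is absorbed by the decoration of the
next node on the same side, or by the middle one. -/
noncomputable def strip (S V : Finset (Fin n)) (x : (Fin n → B) × B) : (Fin n → B) × B :=
  if h : ∃ p, IsNext χ S V p then
    (Function.update x.1 h.choose
      (mulS (χ h.choose) (P.blockVal χ T V x.1 1) (x.1 h.choose)), x.2)
  else (x.1, P.blockVal χ T V x.1 x.2)

/-- The value of a decorated word, obtained by stripping all its blocks. -/
noncomputable def eval (π : Finset (Finset (Fin n))) (x : (Fin n → B) × B) : B :=
  if h : π.Nonempty then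
    have : (π.erase (lastBlock π h)).card < π.card :=
      Finset.card_erase_lt_of_mem (lastBlock_mem π h)
    eval (π.erase (lastBlock π h)) (P.strip χ T (π.sup id) (lastBlock π h) x)
  else x.2
termination_by π.card

variable {χ T}

theorem strip_of_isNext {S V : Finset (Fin n)} {p : Fin n} (h : IsNext χ S V p)
    (d : Fin n → B) (e : B) :
    P.strip χ T S V (d, e) =
      (Function.update d p (mulS (χ p) (P.blockVal χ T V d 1) (d p)), e) := by
  have h' : ∃ p, IsNext χ S V p := ⟨p, h⟩
  have h2 := h'.choose_spec.eq h
  rw [strip, dif_pos h', h2]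

theorem strip_of_not_isNext {S V : Finset (Fin n)} (h : ∀ p, ¬ IsNext χ S V p)
    (d : Fin n → B) (e : B) :
    P.strip χ T S V (d, e) = (d, P.blockVal χ T V d e) := by
  rw [strip, dif_neg (not_exists.2 h)]

theorem eval_eq {π : Finset (Finset (Fin n))} (h : π.Nonempty) (x : (Fin n → B) × B) :
    P.eval χ T π x =
      P.eval χ T (π.erase (lastBlock π h)) (P.strip χ T (π.sup id) (lastBlock π h) x) := by
  rw [eval, dif_pos h]

theorem eval_empty (x : (Fin n → B) × B) : P.eval χ T ∅ x = x.2 := by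
  rw [eval, dif_neg (by simp)]

theorem blockVal_update_of_notMem {V : Finset (Fin n)} {p : Fin n} (hp : p ∉ V)
    (d : Fin n → B) (c e : B) :
    P.blockVal χ T V (Function.update d p c) e = P.blockVal χ T V d e := by
  unfold blockVal
  rw [orderedProd_congr fun k hk => ?_]
  rw [decorate, decorate, Function.update_of_ne fun e => hp (by rwa [← e])]

theorem decorate_update (d : Fin n → B) (p : Fin n) (c : B) :
    P.decorate χ T (Function.update d p (mulS (χ p) c (d p))) =
      Function.update (P.decorate χ T d) p (P.op (χ p) c * P.decorate χ T d p) := by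
  funext k
  by_cases h : k = p
  · subst h
    rw [Function.update_self, decorate, decorate, Function.update_self, op_mulS, mul_assoc]
  · rw [Function.update_of_ne h, decorate, decorate, Function.update_of_ne h]

theorem commute_op_decorate (hT : ∀ k, T k ∈ P.face (χ k)) {s : Side} {k : Fin n}
    (h : s ≠ χ k) (c : B) (d : Fin n → B) : Commute (P.op s c) (P.decorate χ T d k) :=
  (P.commute_op_op h c _).mul_right (P.commute_op_face h c (hT k))

/-- The nodes of `V` before `p` are on the opposite side, so the new factor moves to the front of
the product and leaves `E` by the bimodule property. -/
theorem blockVal_update_first (hT : ∀ k, T k ∈ P.face (χ k)) {V : Finset (Fin n)} {p : Fin n}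
    (hp : p ∈ V) (h : ∀ k ∈ V, k < p → χ k ≠ χ p) (d : Fin n → B) (c e : B) :
    P.blockVal χ T V (Function.update d p (mulS (χ p) c (d p))) e =
      mulS (χ p) c (P.blockVal χ T V d e) := by
  rw [blockVal, decorate_update, orderedProd_update_mul hp fun k hk hkp =>
    P.commute_op_decorate hT (h k hk hkp).symm c d, mul_assoc, E_op_mul, blockVal]

/-- Under `E` the final `L_e` may be replaced by the operator of the side opposite to `V`. That one
commutes with the whole product and comes out of `E` at the far end. -/
theorem blockVal_of_side (hT : ∀ k, T k ∈ P.face (χ k)) {V : Finset (Fin n)} {s : Side}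
    (h : ∀ k ∈ V, χ k = s) (d : Fin n → B) (e : B) :
    P.blockVal χ T V d e = mulS s (P.blockVal χ T V d 1) e := by
  rw [blockVal, blockVal, P.L_one, mul_one]
  cases s
  · have : Commute (P.op Side.right e) (orderedProd (P.decorate χ T d) V) :=
      commute_orderedProd fun k hk => P.commute_op_decorate hT (by simp [h k hk]) e d
    rw [← P.E_mul_op Side.right, ← this.eq, E_op_mul]
    rfl
  · have : Commute (P.op Side.left e) (orderedProd (P.decorate χ T d) V) :=
      commute_orderedProd fun k hk => P.commute_op_decorate hT (by simp [h k hk]) e d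
    rw [← P.E_mul_op Side.left, ← this.eq, E_op_mul]
    rfl

theorem blockVal_congr {V : Finset (Fin n)} {d d' : Fin n → B} (h : ∀ k ∈ V, d k = d' k) (e : B) :
    P.blockVal χ T V d e = P.blockVal χ T V d' e := by
  unfold blockVal
  rw [orderedProd_congr fun k hk => ?_]
  rw [decorate, decorate, h k hk]

theorem strip_congr {S V : Finset (Fin n)} (hV : V ⊆ S) {x y : (Fin n → B) × B}
    (h : Agree S x y) : Agree S (P.strip χ T S V x) (P.strip χ T S V y) := by
  obtain ⟨d, e⟩ := x
  obtain ⟨d', e'⟩ := y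
  obtain ⟨h1, rfl : e = e'⟩ := h
  by_cases hp : ∃ p, IsNext χ S V p
  · obtain ⟨p, hp⟩ := hp
    rw [P.strip_of_isNext hp, P.strip_of_isNext hp,
      P.blockVal_congr fun k hk => h1 k (hV hk)]
    refine ⟨fun k hk => ?_, rfl⟩
    change Function.update _ _ _ k = Function.update _ _ _ k
    by_cases hkp : k = p
    · subst hkp
      simp only [Function.update_self]
      exact congrArg _ (h1 k hk)
    · simp only [Function.update_of_ne hkp]
      exact h1 k hk
  · rw [P.strip_of_not_isNext (not_exists.1 hp), P.strip_of_not_isNext (not_exists.1 hp),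
      P.blockVal_congr fun k hk => h1 k (hV hk)]
    exact ⟨h1, rfl⟩

theorem eval_congr {π : Finset (Finset (Fin n))} {x y : (Fin n → B) × B}
    (h : Agree (π.sup id) x y) : P.eval χ T π x = P.eval χ T π y := by
  induction hk : π.card generalizing π x y with
  | zero =>
    obtain rfl := Finset.card_eq_zero.1 hk
    rw [eval_empty, eval_empty, h.2]
  | succ k ih =>
    have hne : π.Nonempty := Finset.card_pos.1 (by omega)
    rw [P.eval_eq hne, P.eval_eq hne]
    have hV := lastBlock_mem π hne
    refine ih ((P.strip_congr (Finset.le_sup (f := id) hV) h).mono ?_) ?_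
    · exact Finset.sup_mono (Finset.erase_subset _ _)
    · rw [Finset.card_erase_of_mem hV, hk, Nat.add_sub_cancel]

/-! ### Independence of the stripping order -/

theorem isNext_sdiff_iff {S V V' : Finset (Fin n)}
    (h : ∀ p, IsNext χ S V p → p ∉ V') (p : Fin n) :
    IsNext χ (S \ V') V p ↔ IsNext χ S V p := by
  have key : ∀ p, IsNext χ S V p → IsNext χ (S \ V') V p := by
    intro p hp
    have h1 := h p hp
    obtain ⟨hpS, hpV, m, hm, hpm, hlt, hle⟩ := hp
    exact ⟨Finset.mem_sdiff.2 ⟨hpS, h1⟩, hpV, m, hm, hpm, hlt, fun x hx =>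
      hle x (Finset.mem_sdiff.1 hx).1⟩
  refine ⟨fun hp => ?_, key p⟩
  obtain ⟨hpS, hpV, m, hm, hpm, hlt, -⟩ := id hp
  obtain ⟨p', hp'⟩ := exists_isNext hm (Finset.mem_sdiff.1 hpS).1 hpV hpm hlt
  rwa [hp.eq (key p' hp')]

/-- This is the nested case: the value of `V` is either absorbed by `V'` through `p`, or passed on
after `V'` has gone. By associativity it ends up in front of the value of `V'` both ways. Agreement
is only required on the remaining nodes, since the two orders leave different decorations at `p`. -/
theorem strip_comm_of_next_mem (hT : ∀ k, T k ∈ P.face (χ k)) {S V V' : Finset (Fin n)}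
    (hV : IsInterval χ S V) (hV' : IsInterval χ S V') (hVS : V ⊆ S) (hVS' : V' ⊆ S)
    (hne' : V'.Nonempty) (hd : Disjoint V V')
    {p : Fin n} (hp : IsNext χ S V p) (hpV' : p ∈ V') (x : (Fin n → B) × B) :
    Agree ((S \ V) \ V') (P.strip χ T (S \ V) V' (P.strip χ T S V x))
      (P.strip χ T (S \ V') V (P.strip χ T S V' x)) := by
  obtain ⟨d, e⟩ := x
  have hlt := hp.forall_lt hV
  obtain ⟨hpS, hpV, m, hm, hpm, hmp, hle⟩ := id hp
  have hd1 : ∀ v ∈ V, v ∉ V' := fun v hv => Finset.disjoint_left.1 hd hv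
  obtain ⟨m', hm'⟩ := exists_isMin hne'
  -- An earlier node of `V'` on the side of `p` would lie either between `m` and `p`, contradicting
  -- the choice of `p`, or before `m`, forcing `m` into `V'`.
  have hfirst : ∀ k ∈ V', k < p → χ k ≠ χ p := by
    intro k hk hkp hχ
    have hkV : k ∉ V := fun h => hd1 k h hk
    by_cases hmk : m < k
    · exact absurd (hle k (hVS' hk) hkV (hχ.trans hpm) hmk) (not_le.2 hkp)
    · have : k < m := lt_of_le_of_ne (not_lt.1 hmk) fun e => hkV (e ▸ hm.1)
      exact hd1 m hm.1 (hV'.same k hk p hpV' m (hVS hm.1) (hχ.trans hpm) hpm this hmp)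
  rw [P.strip_of_isNext hp]
  by_cases hq : ∃ q, IsNext χ S V' q
  · obtain ⟨q, hq⟩ := hq
    have hlt' := hq.forall_lt hV'
    have hpq := hlt' p hpV'
    have hqV : q ∉ V := fun h => (hpq.2.trans (hlt q h).2).false
    have hq2 : IsNext χ (S \ V) V' q := by
      obtain ⟨h1, h2, m', h3, h4, h5, h6⟩ := hq
      exact ⟨Finset.mem_sdiff.2 ⟨h1, hqV⟩, h2, m', h3, h4, h5, fun x hx =>
        h6 x (Finset.mem_sdiff.1 hx).1⟩
    -- Once `V'` is removed, its next node becomes that of `V`: the remaining nodes after `m` on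
    -- this side lie beyond `p`, hence beyond the minimum of `V'`.
    have hq3 : IsNext χ (S \ V') V q := by
      obtain ⟨h1, h2, m'', h3, h4, h5, h6⟩ := hq
      refine ⟨Finset.mem_sdiff.2 ⟨h1, h2⟩, hqV, m, hm, hpq.1.symm.trans hpm, hmp.trans hpq.2, ?_⟩
      intro x hx hxV hxm hmx
      have hx := Finset.mem_sdiff.1 hx
      refine h6 x hx.1 hx.2 ?_ ?_
      · rw [hxm, ← hpm, hpq.1, h4]
      · exact (h3.2 p hpV').trans_lt (lt_of_le_of_ne (hle x hx.1 hxV hxm hmx)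
          fun e => hx.2 (e ▸ hpV'))
    have hqp : q ≠ p := hpq.2.ne'
    rw [P.strip_of_isNext hq2, P.strip_of_isNext hq, P.strip_of_isNext hq3,
      P.blockVal_update_of_notMem hqV, P.blockVal_update_first hT hpV' hfirst,
      Function.update_self, Function.update_of_ne hqp, ← hpq.1, mulS_assoc]
    refine ⟨fun k hk => ?_, rfl⟩
    simp only [Finset.mem_sdiff] at hk
    have hkp : k ≠ p := fun e => hk.2 (e ▸ hpV')
    by_cases hkq : k = q
    · subst hkq
      simp [hpq.1]
    · simp [hkq, hkp]
  · have hq' := not_exists.1 hq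
    have hq2 : ∀ q, ¬ IsNext χ (S \ V) V' q := fun q h =>
      hq' q ((isNext_sdiff_iff (fun p hp => absurd hp (hq' p)) q).1 h)
    have hq3 : ∀ q, ¬ IsNext χ (S \ V') V q := by
      rintro q ⟨h1, h2, m1, h3, h4, h5, h6⟩
      obtain rfl := hm.eq h3
      have h1 := Finset.mem_sdiff.1 h1
      have hpq : p < q := lt_of_le_of_ne (hle q h1.1 h2 h4 h5) fun e => h1.2 (e ▸ hpV')
      by_cases hs : χ m' = χ q
      · obtain ⟨r, hr⟩ := exists_isNext hm' h1.1 h1.2 hs.symm ((hm'.2 p hpV').trans_lt hpq)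
        exact hq' r hr
      · exact h1.2 (hV'.opposite p hpV' m' hm'.1 q h1.1 (hpm.trans h4.symm) hs hpq)
    rw [P.strip_of_not_isNext hq2, P.strip_of_not_isNext hq', P.strip_of_not_isNext hq3,
      P.blockVal_update_first hT hpV' hfirst,
      P.blockVal_of_side hT (fun k hk => (hlt k hk).1) d (P.blockVal χ T V' d e)]
    refine ⟨fun k hk => ?_, rfl⟩
    simp only [Finset.mem_sdiff] at hk
    have hkp : k ≠ p := fun e => hk.2 (e ▸ hpV')
    simp [hkp]

/-- If the two minima were on one side, the later one would witness a next node for the other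
interval. -/
theorem side_ne_of_not_isNext {S V V' : Finset (Fin n)} (hVS : V ⊆ S) (hVS' : V' ⊆ S)
    (hd : Disjoint V V') (h : ∀ p, ¬ IsNext χ S V p) (h' : ∀ p, ¬ IsNext χ S V' p)
    {m m' : Fin n} (hm : IsMin V m) (hm' : IsMin V' m') : χ m ≠ χ m' := by
  intro hs
  rcases lt_trichotomy m m' with hlt | rfl | hlt
  · obtain ⟨p, hp⟩ := exists_isNext hm (hVS' hm'.1)
      (fun hv => Finset.disjoint_left.1 hd hv hm'.1) hs.symm hlt
    exact h p hp
  · exact Finset.disjoint_left.1 hd hm.1 hm'.1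
  · obtain ⟨p, hp⟩ := exists_isNext hm' (hVS hm.1)
      (fun hv => Finset.disjoint_left.1 hd hm.1 hv) hs hlt
    exact h' p hp

/-- Of two disjoint intervals without next node, each lies on one side. -/
theorem side_of_not_isNext {S V V' : Finset (Fin n)} (hV : IsInterval χ S V)
    (hVS : V ⊆ S) (hVS' : V' ⊆ S)
    (hd : Disjoint V V') (h : ∀ p, ¬ IsNext χ S V p) (h' : ∀ p, ¬ IsNext χ S V' p)
    {m m' : Fin n} (hm : IsMin V m) (hm' : IsMin V' m') : ∀ k ∈ V, χ k = χ m := by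
  have hs := side_ne_of_not_isNext hVS hVS' hd h h' hm hm'
  intro k hk
  by_contra hkm
  have hkm' : χ k = χ m' := by
    revert hs hkm
    cases χ k <;> cases χ m <;> cases χ m' <;> simp
  have hkV' : k ∉ V' := fun hv => Finset.disjoint_left.1 hd hk hv
  rcases lt_trichotomy m' k with hlt | rfl | hlt
  · obtain ⟨p, hp⟩ := exists_isNext hm' (hVS hk) hkV' hkm' hlt
    exact h' p hp
  · exact hkV' hm'.1
  · exact Finset.disjoint_left.1 hd
      (hV.opposite k hk m hm.1 m' (hVS' hm'.1) hkm' hs hlt) hm'.1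

/-- The order in which two intervals are stripped does not matter. -/
theorem strip_comm (hT : ∀ k, T k ∈ P.face (χ k)) {S V V' : Finset (Fin n)}
    (hV : IsInterval χ S V) (hV' : IsInterval χ S V') (hVS : V ⊆ S) (hVS' : V' ⊆ S)
    (hne : V.Nonempty) (hne' : V'.Nonempty) (hd : Disjoint V V') (x : (Fin n → B) × B) :
    Agree ((S \ V) \ V') (P.strip χ T (S \ V) V' (P.strip χ T S V x))
      (P.strip χ T (S \ V') V (P.strip χ T S V' x)) := by
  by_cases h1 : ∃ p, IsNext χ S V p ∧ p ∈ V'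
  · obtain ⟨p, hp, hpV'⟩ := h1
    exact P.strip_comm_of_next_mem hT hV hV' hVS hVS' hne' hd hp hpV' x
  by_cases h2 : ∃ p, IsNext χ S V' p ∧ p ∈ V
  · obtain ⟨p, hp, hpV⟩ := h2
    have := P.strip_comm_of_next_mem hT hV' hV hVS' hVS hne hd.symm hp hpV x
    rw [sdiff_right_comm]
    exact ⟨fun k hk => (this.1 k hk).symm, this.2.symm⟩
  have h1' : ∀ p, IsNext χ (S \ V') V p ↔ IsNext χ S V p :=
    isNext_sdiff_iff fun p hp hpV => h1 ⟨p, hp, hpV⟩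
  have h2' : ∀ p, IsNext χ (S \ V) V' p ↔ IsNext χ S V' p :=
    isNext_sdiff_iff fun p hp hpV => h2 ⟨p, hp, hpV⟩
  obtain ⟨d, e⟩ := x
  suffices h : P.strip χ T (S \ V) V' (P.strip χ T S V (d, e)) =
      P.strip χ T (S \ V') V (P.strip χ T S V' (d, e)) by
    rw [h]; exact ⟨fun _ _ => rfl, rfl⟩
  by_cases hp : ∃ p, IsNext χ S V p
  · obtain ⟨p, hp⟩ := hp
    have hpV' : p ∉ V' := fun h => h1 ⟨p, hp, h⟩
    rw [P.strip_of_isNext hp]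
    by_cases hq : ∃ q, IsNext χ S V' q
    · obtain ⟨q, hq⟩ := hq
      have hqV : q ∉ V := fun h => h2 ⟨q, hq, h⟩
      -- Two intervals cannot share a next node, since the larger of their minima would come before
      -- it and qualify instead.
      have hpq : p ≠ q := by
        rintro rfl
        obtain ⟨hpS, hpV, m, hm, hpm, hlt, hle⟩ := hp
        obtain ⟨-, -, m', hm', hpm', hlt', hle'⟩ := hq
        rcases lt_trichotomy m m' with h | rfl | h
        · exact absurd (hle m' (hVS' hm'.1) (fun hv => Finset.disjoint_left.1 hd hv hm'.1)
            (hpm'.symm.trans hpm) h) (not_le.2 hlt')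
        · exact Finset.disjoint_left.1 hd hm.1 hm'.1
        · exact absurd (hle' m (hVS hm.1) (fun hv => Finset.disjoint_left.1 hd hm.1 hv)
            (hpm.symm.trans hpm') h) (not_le.2 hlt)
      rw [P.strip_of_isNext ((h2' q).2 hq), P.strip_of_isNext hq,
        P.strip_of_isNext ((h1' p).2 hp), P.blockVal_update_of_notMem hpV',
        P.blockVal_update_of_notMem hqV, Function.update_of_ne hpq.symm,
        Function.update_of_ne hpq, Function.update_comm hpq]
    · have hq' := not_exists.1 hq
      rw [P.strip_of_not_isNext fun q hq => hq' q ((h2' q).1 hq), P.strip_of_not_isNext hq',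
        P.strip_of_isNext ((h1' p).2 hp), P.blockVal_update_of_notMem hpV']
  · have hp' := not_exists.1 hp
    rw [P.strip_of_not_isNext hp']
    by_cases hq : ∃ q, IsNext χ S V' q
    · obtain ⟨q, hq⟩ := hq
      have hqV : q ∉ V := fun h => h2 ⟨q, hq, h⟩
      rw [P.strip_of_isNext ((h2' q).2 hq), P.strip_of_isNext hq,
        P.strip_of_not_isNext fun p hp => hp' p ((h1' p).1 hp), P.blockVal_update_of_notMem hqV]
    · have hq' := not_exists.1 hq
      rw [P.strip_of_not_isNext fun q hq => hq' q ((h2' q).1 hq), P.strip_of_not_isNext hq',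
        P.strip_of_not_isNext fun p hp => hp' p ((h1' p).1 hp)]
      -- Both values go into the middle. The intervals lie entirely on opposite sides, so one value
      -- multiplies from the left and the other from the right.
      obtain ⟨m, hm⟩ := exists_isMin hne
      obtain ⟨m', hm'⟩ := exists_isMin hne'
      rw [P.blockVal_of_side hT (side_of_not_isNext hV hVS hVS' hd hp' hq' hm hm') d
          (P.blockVal χ T V' d e),
        P.blockVal_of_side hT (side_of_not_isNext hV' hVS' hVS hd.symm hq' hp' hm' hm) d e,
        P.blockVal_of_side hT (side_of_not_isNext hV' hVS' hVS hd.symm hq' hp' hm' hm) d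
          (P.blockVal χ T V d e),
        P.blockVal_of_side hT (side_of_not_isNext hV hVS hVS' hd hp' hq' hm hm') d e,
        mulS_comm (side_ne_of_not_isNext hVS hVS' hd hp' hq' hm hm')]

/-- Any interval may be stripped first. -/
theorem eval_eq_of_isInterval (hT : ∀ k, T k ∈ P.face (χ k)) {π : Finset (Finset (Fin n))}
    (hπ : IsBlocks χ π) {V : Finset (Fin n)} (hV : V ∈ π) (hI : IsInterval χ (π.sup id) V)
    (x : (Fin n → B) × B) :
    P.eval χ T π x = P.eval χ T (π.erase V) (P.strip χ T (π.sup id) V x) := by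
  induction hk : π.card generalizing π V x with
  | zero =>
    obtain rfl := Finset.card_eq_zero.1 hk
    simp at hV
  | succ k ih =>
    have hne : π.Nonempty := ⟨V, hV⟩
    have hI0 := isInterval_lastBlock hπ hne
    have hV0 := lastBlock_mem π hne
    rw [P.eval_eq hne]
    generalize lastBlock π hne = V0 at *
    by_cases hVV : V = V0
    · rw [hVV]
    have hd : Disjoint V V0 := Finset.disjoint_left.2 fun i h h' =>
      hVV (hπ.disjoint V hV V0 hV0 i h h')
    have hs : ∀ U : Finset (Fin n), (π.erase U).sup id ⊆ π.sup id := fun U =>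
      Finset.sup_mono (Finset.erase_subset _ _)
    -- By induction `V` may follow `V0` on one side of the equation and `V0` may follow `V` on the
    -- other; `strip_comm` then exchanges them.
    rw [ih (hπ.erase V0) (Finset.mem_erase.2 ⟨hVV, hV⟩) (hI.mono (hs _)) _
        (by rw [Finset.card_erase_of_mem hV0, hk, Nat.add_sub_cancel]),
      ih (hπ.erase V) (Finset.mem_erase.2 ⟨Ne.symm hVV, hV0⟩) (hI0.mono (hs _)) _
        (by rw [Finset.card_erase_of_mem hV, hk, Nat.add_sub_cancel]),
      Finset.erase_right_comm]
    refine P.eval_congr ?_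
    rw [(hπ.erase V).nodes_erase (Finset.mem_erase.2 ⟨Ne.symm hVV, hV0⟩), hπ.nodes_erase hV,
      hπ.nodes_erase hV0, sdiff_right_comm]
    exact P.strip_comm hT hI0 hI (Finset.le_sup (f := id) hV0) (Finset.le_sup (f := id) hV)
      (hπ.nonempty _ hV0) (hπ.nonempty _ hV) hd.symm x

end BBSpace

/-! ### Splitting off a node -/

section Split

variable {n : ℕ} {χ : Fin n → Side}

/-- The blocks of `π` with the node `q` split off the block `W`. -/
def splitOff (π : Finset (Finset (Fin n))) (W : Finset (Fin n)) (q : Fin n) :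
    Finset (Finset (Fin n)) :=
  insert {q} (insert (W.erase q) (π.erase W))

theorem isInterval_singleton (S : Finset (Fin n)) (q : Fin n) : IsInterval χ S {q} where
  same u hu w hw x _ _ _ h1 h2 := by
    obtain rfl := Finset.mem_singleton.1 hu
    obtain rfl := Finset.mem_singleton.1 hw
    exact absurd (h1.trans h2) (lt_irrefl _)
  opposite u hu w hw x _ h1 h2 := by
    obtain rfl := Finset.mem_singleton.1 hu
    obtain rfl := Finset.mem_singleton.1 hw
    exact absurd h1 h2

theorem IsInterval.erase {S W : Finset (Fin n)} (h : IsInterval χ S W) (q : Fin n) :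
    IsInterval χ (S \ {q}) (W.erase q) where
  same u hu w hw x hx h1 h2 h3 h4 := by
    simp only [Finset.mem_sdiff, Finset.mem_singleton] at hx
    exact Finset.mem_erase.2 ⟨hx.2, h.same u (Finset.mem_of_mem_erase hu) w
      (Finset.mem_of_mem_erase hw) x hx.1 h1 h2 h3 h4⟩
  opposite u hu w hw x hx h1 h2 h3 := by
    simp only [Finset.mem_sdiff, Finset.mem_singleton] at hx
    exact Finset.mem_erase.2 ⟨hx.2, h.opposite u (Finset.mem_of_mem_erase hu) w
      (Finset.mem_of_mem_erase hw) x hx.1 h1 h2 h3⟩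

theorem prec_asymm {a b : Fin n} (h : prec χ a b) : ¬ prec χ b a := by
  unfold prec at *; omega

theorem IsBlocks.splitOff {π : Finset (Finset (Fin n))} (h : IsBlocks χ π)
    {W : Finset (Fin n)} (hW : W ∈ π) {q : Fin n} (hq : q ∈ W) (hne : (W.erase q).Nonempty) :
    IsBlocks χ (splitOff π W q) where
  nonempty V hV := by
    simp only [BiFree.splitOff, Finset.mem_insert, Finset.mem_erase] at hV
    rcases hV with rfl | rfl | hV
    · exact Finset.singleton_nonempty q
    · exact hne
    · exact h.nonempty V hV.2
  disjoint U hU V hV i hi hi' := by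
    simp only [BiFree.splitOff, Finset.mem_insert, Finset.mem_erase] at hU hV
    have := h.disjoint
    rcases hU with rfl | rfl | hU <;> rcases hV with rfl | rfl | hV <;>
      (try simp only [Finset.mem_singleton, Finset.mem_erase] at hi hi') <;> grind
  nonCrossing U hU V hV u₁ hu₁ u₂ hu₂ v₁ hv₁ v₂ hv₂ h1 h2 h3 := by
    simp only [BiFree.splitOff, Finset.mem_insert, Finset.mem_erase] at hU hV
    rcases hU with rfl | hU
    · rw [Finset.mem_singleton.1 hu₁] at h1
      rw [Finset.mem_singleton.1 hu₂] at h2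
      exact absurd h2 (prec_asymm h1)
    rcases hV with rfl | hV
    · rw [Finset.mem_singleton.1 hv₁] at h2
      rw [Finset.mem_singleton.1 hv₂] at h3
      exact absurd h3 (prec_asymm h2)
    rcases hU with rfl | hU <;> rcases hV with rfl | hV
    · rfl
    · exact absurd (h.nonCrossing W hW V hV.2 u₁ (Finset.mem_of_mem_erase hu₁) u₂
        (Finset.mem_of_mem_erase hu₂) v₁ hv₁ v₂ hv₂ h1 h2 h3).symm hV.1
    · exact absurd (h.nonCrossing U hU.2 W hW u₁ hu₁ u₂ hu₂ v₁ (Finset.mem_of_mem_erase hv₁) v₂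
        (Finset.mem_of_mem_erase hv₂) h1 h2 h3) hU.1
    · exact h.nonCrossing U hU.2 V hV.2 u₁ hu₁ u₂ hu₂ v₁ hv₁ v₂ hv₂ h1 h2 h3

theorem nodes_splitOff {π : Finset (Finset (Fin n))} {W : Finset (Fin n)} (hW : W ∈ π)
    {q : Fin n} (hq : q ∈ W) : (splitOff π W q).sup id = π.sup id := by
  rw [splitOff, Finset.sup_insert, Finset.sup_insert, ← sup_assoc]
  have : id {q} ⊔ id (W.erase q) = id W := by
    ext i; simp only [id, Finset.sup_eq_union, Finset.mem_union, Finset.mem_singleton,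
      Finset.mem_erase]; grind
  rw [this, ← Finset.sup_insert, Finset.insert_erase hW]

theorem IsNext.erase {S W : Finset (Fin n)} (hI : IsInterval χ S W) {q r : Fin n}
    (hne : (W.erase q).Nonempty) (hr : IsNext χ S W r) (hq : q ∈ W) :
    IsNext χ (S \ {q}) (W.erase q) r := by
  have hlt := hr.forall_lt hI
  obtain ⟨hrS, hrW, m, hm, hrm, hmr, hle⟩ := hr
  obtain ⟨m', hm'⟩ := exists_isMin hne
  have hm'W := Finset.mem_of_mem_erase hm'.1
  refine ⟨?_, fun h => hrW (Finset.mem_of_mem_erase h), m', hm', (hlt m' hm'W).1.symm,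
    (hlt m' hm'W).2, fun x hx hxW hxm hlt' => ?_⟩
  · rw [Finset.mem_sdiff, Finset.mem_singleton]
    exact ⟨hrS, fun e => hrW (e ▸ hq)⟩
  · rw [Finset.mem_sdiff, Finset.mem_singleton] at hx
    exact hle x hx.1 (fun h => hxW (Finset.mem_erase.2 ⟨hx.2, h⟩))
      (hxm.trans ((hlt m' hm'W).1.trans hrm)) ((hm.2 m' hm'W).trans_lt hlt')

/-- The node `p` fixes the side: even if `q` was the minimum of `W`, the next node of `W \ {q}` is
on the side of `p`, hence of `q`, and after both. -/
theorem IsNext.of_erase {S W : Finset (Fin n)} (hI : IsInterval χ S W)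
    {p q r : Fin n} (hr : IsNext χ (S \ {q}) (W.erase q) r) (hq : q ∈ W) (hp : p ∈ W)
    (hqp : q < p) (hχ : χ p = χ q) : IsNext χ S W r := by
  have hlt := hr.forall_lt (hI.erase q)
  obtain ⟨hrS, hrW, m', hm', hrm, hmr, hle⟩ := hr
  have hrS' := Finset.mem_sdiff.1 hrS
  rw [Finset.mem_singleton] at hrS'
  have hp' := hlt p (Finset.mem_erase.2 ⟨hqp.ne', hp⟩)
  have hrW' : r ∉ W := fun h => hrW (Finset.mem_erase.2 ⟨hrS'.2, h⟩)
  obtain ⟨m, hm⟩ := exists_isMin (V := W) ⟨q, hq⟩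
  have hm'W := Finset.mem_of_mem_erase hm'.1
  have hmχ : χ m = χ r ∧ m < r := by
    by_cases hmq : m = q
    · rw [hmq, ← hχ]
      exact ⟨hp'.1, hqp.trans hp'.2⟩
    · exact hlt m (Finset.mem_erase.2 ⟨hmq, hm.1⟩)
  refine ⟨hrS'.1, hrW', m, hm, hmχ.1.symm, hmχ.2, fun x hx hxW hxm hmx => ?_⟩
  have hxq : x ≠ q := fun e => hxW (e ▸ hq)
  refine hle x (by simp [hx, hxq]) (fun h => hxW (Finset.mem_of_mem_erase h))
    (hxm.trans (hmχ.1.trans hrm)) (lt_of_not_ge fun h => ?_)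
  rcases h.eq_or_lt with rfl | h
  · exact hxW hm'W
  · exact hxW (hI.same m hm.1 m' hm'W x hx hxm.symm
      (hrm.symm.trans (hmχ.1.symm.trans hxm.symm)) hmx h)

end Split

namespace BBSpace

variable {B A : Type*} [Ring B] [Algebra ℂ B] [Ring A] [Algebra ℂ A] (P : BBSpace B A) {n : ℕ}
  {χ : Fin n → Side} {T : Fin n → A}

theorem E_L (e : B) : P.E (P.L e) = e := by
  have := P.E_op_mul Side.left e 1
  rw [mul_one, P.E_one, mulS_one] at this
  exact this

theorem decorate_op {q : Fin n} {b : B} (hb : T q = P.op (χ q) b) (d : Fin n → B) :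
    P.decorate χ T d q = P.op (χ q) (mulS (χ q) (d q) b) := by
  rw [decorate, hb, op_mulS]

theorem blockVal_singleton_op {q : Fin n} {b : B} (hb : T q = P.op (χ q) b) (d : Fin n → B)
    (e : B) : P.blockVal χ T {q} d e = mulS (χ q) (mulS (χ q) (d q) b) e := by
  rw [blockVal, orderedProd_singleton, P.decorate_op hb, E_op_mul, E_L]

theorem blockVal_erase_last (hT : ∀ k, T k ∈ P.face (χ k)) {W : Finset (Fin n)} {q : Fin n}
    {b : B} (hb : T q = P.op (χ q) b) (hq : q ∈ W) (h : ∀ k ∈ W, q < k → χ k ≠ χ q)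
    (d : Fin n → B) (e : B) :
    P.blockVal χ T W d e =
      P.blockVal χ T (W.erase q) d (mulS (χ q) (mulS (χ q) (d q) b) e) := by
  rw [blockVal, orderedProd_erase_last hq, P.decorate_op hb, E_mul_op_mul_L, blockVal]
  intro k hk hqk
  rw [P.decorate_op hb]
  exact P.commute_op_decorate hT (h k hk hqk).symm _ _

theorem blockVal_erase_next (hT : ∀ k, T k ∈ P.face (χ k)) {W : Finset (Fin n)} {p q : Fin n}
    {b : B} (hb : T q = P.op (χ q) b) (hq : q ∈ W) (hp : p ∈ W) (hqp : q < p) (hχ : χ p = χ q)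
    (h : ∀ k ∈ W, q < k → k < p → χ k ≠ χ q) (d : Fin n → B) (e : B) :
    P.blockVal χ T W d e = P.blockVal χ T (W.erase q)
      (Function.update d p (mulS (χ p) (mulS (χ q) (d q) b) (d p))) e := by
  rw [blockVal, blockVal, decorate_update, orderedProd_erase_next hq hp hqp, P.decorate_op hb, hχ]
  intro k hk hqk hkp
  rw [P.decorate_op hb]
  exact P.commute_op_decorate hT (h k hk hqk hkp).symm _ _

/-- The operator at `q` moves right past nodes of the other side. It is absorbed by the next node
`p` on its side if `p` is in `W`; otherwise it reaches the end of the product, where it multiplies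
the value of `W \ {q}` or merges with the middle element. Stripping `{q}` first puts it in the same
place. -/
theorem strip_split (hT : ∀ k, T k ∈ P.face (χ k)) {S W : Finset (Fin n)}
    (hI : IsInterval χ S W) (hWS : W ⊆ S) {q : Fin n} {b : B} (hb : T q = P.op (χ q) b)
    (hq : q ∈ W) (hne : (W.erase q).Nonempty) (x : (Fin n → B) × B) :
    Agree (S \ W) (P.strip χ T S W x)
      (P.strip χ T (S \ {q}) (W.erase q) (P.strip χ T S {q} x)) := by
  obtain ⟨d, e⟩ := x
  have hqmin : IsMin {q} q := ⟨by simp, fun v hv => (Finset.mem_singleton.1 hv).ge⟩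
  by_cases hp : ∃ p, IsNext χ S {q} p
  · obtain ⟨p, hp⟩ := hp
    obtain ⟨hpS, hpq, m0, hm0, hpχ, hlt, hle⟩ := id hp
    obtain rfl := hqmin.eq hm0
    have hle' : ∀ x ∈ S, χ x = χ q → q < x → p ≤ x := fun x hx h1 h2 =>
      hle x hx (by simpa using h2.ne') h1 h2
    rw [P.strip_of_isNext hp, P.blockVal_singleton_op hb, mulS_one]
    by_cases hpW : p ∈ W
    · have hval : ∀ e, P.blockVal χ T W d e = _ := fun e =>
        P.blockVal_erase_next hT hb hq hpW hlt hpχ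
          (fun k hk h1 h2 h3 => (h2.trans_le (hle' k (hWS hk) h3 h1)).false) d e
      by_cases hr : ∃ r, IsNext χ S W r
      · obtain ⟨r, hr⟩ := hr
        have hrp : r ≠ p := fun e => hr.2.1 (e ▸ hpW)
        rw [P.strip_of_isNext hr, P.strip_of_isNext (hr.erase hI hne hq), hval,
          Function.update_of_ne hrp]
        refine ⟨fun k hk => ?_, rfl⟩
        have hkp : k ≠ p := fun e => (Finset.mem_sdiff.1 hk).2 (e ▸ hpW)
        by_cases hkr : k = r
        · subst hkr; simp
        · simp [hkr, hkp]
      · have hr' := not_exists.1 hr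
        rw [P.strip_of_not_isNext hr', P.strip_of_not_isNext fun r h =>
          hr' r (h.of_erase hI hq hpW hlt hpχ), hval]
        refine ⟨fun k hk => ?_, rfl⟩
        have hkp : k ≠ p := fun e => (Finset.mem_sdiff.1 hk).2 (e ▸ hpW)
        simp [hkp]
    -- Since `p` lies outside the interval `W`, all of `W` is on the side of `q`, with `q` last, and
    -- `p` is also the next node of `W`.
    · have hside : ∀ v ∈ W, χ v = χ q := by
        intro v hv
        by_contra h
        exact hpW (hI.opposite q hq v hv p hpS hpχ.symm (fun e => h (e.trans hpχ)) hlt)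
      have hlast : ∀ v ∈ W, v ≤ q := by
        intro v hv
        refine le_of_not_gt fun h => ?_
        rcases (hle' v (hWS hv) (hside v hv) h).eq_or_lt with rfl | h'
        · exact hpW hv
        · exact hpW (hI.same q hq v hv p hpS hpχ.symm ((hside v hv).trans hpχ.symm) hlt h')
      have hpW' : IsNext χ S W p := by
        obtain ⟨m, hm⟩ := exists_isMin (V := W) ⟨q, hq⟩
        refine ⟨hpS, hpW, m, hm, hpχ.trans (hside m hm.1).symm, (hlast m hm.1).trans_lt hlt,
          fun x hx hxW hxm hmx => ?_⟩
        rcases lt_trichotomy x q with h | rfl | h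
        · exact absurd (hI.same m hm.1 q hq x hx hxm.symm
            (((hside m hm.1).symm.trans hxm.symm)) hmx h) hxW
        · exact absurd hq hxW
        · exact hle' x hx (hxm.trans (hside m hm.1)) h
      rw [P.strip_of_isNext hpW', P.strip_of_isNext (hpW'.erase hI hne hq),
        P.blockVal_update_of_notMem fun h => hpW (Finset.mem_of_mem_erase h),
        P.blockVal_erase_last hT hb hq (fun k hk h => absurd (hlast k hk) (not_le.2 h)),
        mulS_one, P.blockVal_of_side hT (s := χ q) (V := W.erase q)
          (fun k hk => hside k (Finset.mem_of_mem_erase hk)) d (mulS (χ q) (d q) b),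
        Function.update_self, Function.update_idem, ← hpχ, mulS_assoc]
      exact ⟨fun _ _ => rfl, rfl⟩
  · have hp' : ∀ x ∈ S, χ x = χ q → ¬ q < x := fun x hx h1 h2 =>
      hp (exists_isNext hqmin hx (by simpa using h2.ne') h1 h2)
    have h1 : ∀ r, ¬ IsNext χ S W r := fun r hr =>
      hp' r hr.1 (hr.forall_lt hI q hq).1.symm (hr.forall_lt hI q hq).2
    have h2 : ∀ r, ¬ IsNext χ (S \ {q}) (W.erase q) r := by
      intro r hr
      obtain ⟨hrS, hrW, m', hm', hrm, hmr, -⟩ := hr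
      rw [Finset.mem_sdiff, Finset.mem_singleton] at hrS
      have hrW' : r ∉ W := fun h => hrW (Finset.mem_erase.2 ⟨hrS.2, h⟩)
      have hm'W := Finset.mem_of_mem_erase hm'.1
      by_cases hs : χ q = χ r
      · rcases lt_or_gt_of_ne hrS.2 with h | h
        · exact hrW' (hI.same m' hm'W q hq r hrS.1 hrm.symm hs hmr h)
        · exact hp' r hrS.1 hs.symm h
      · exact hrW' (hI.opposite m' hm'W q hq r hrS.1 hrm.symm hs hmr)
    rw [P.strip_of_not_isNext h1, P.strip_of_not_isNext (not_exists.1 hp),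
      P.strip_of_not_isNext h2, P.blockVal_singleton_op hb,
      P.blockVal_erase_last hT hb hq fun k hk h3 h4 => hp' k (hWS hk) h4 h3]
    exact ⟨fun _ _ => rfl, rfl⟩

/-- A node carrying an operator `L_b` or `R_b` may be split off its block. -/
theorem eval_splitOff (hT : ∀ k, T k ∈ P.face (χ k)) {π : Finset (Finset (Fin n))}
    (hπ : IsBlocks χ π) {W : Finset (Fin n)} (hW : W ∈ π) {q : Fin n} {b : B}
    (hb : T q = P.op (χ q) b) (hq : q ∈ W) (hne : (W.erase q).Nonempty)
    (x : (Fin n → B) × B) : P.eval χ T π x = P.eval χ T (splitOff π W q) x := by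
  induction hk : π.card generalizing π x with
  | zero =>
    obtain rfl := Finset.card_eq_zero.1 hk
    simp at hW
  | succ k ih =>
    have hsplit := hπ.splitOff hW hq hne
    have hnodes := nodes_splitOff hW hq
    have hqW : {q} ≠ W.erase q := fun e => by
      have : q ∈ W.erase q := e ▸ Finset.mem_singleton_self q
      simp at this
    obtain ⟨w, hw⟩ := id hne
    have hwW := Finset.mem_of_mem_erase hw
    have hVq : ∀ V ∈ π, V ≠ W → V ≠ {q} ∧ V ≠ W.erase q := fun V hV hVW =>
      ⟨fun e => hVW (hπ.disjoint V hV W hW q (by simp [e]) hq),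
        fun e => hVW (hπ.disjoint V hV W hW w (e ▸ hw) hwW)⟩
    by_cases hV : ∃ V ∈ π, V ≠ W ∧ IsInterval χ (π.sup id) V
    · obtain ⟨V, hV, hVW, hI⟩ := hV
      obtain ⟨h1, h2⟩ := hVq V hV hVW
      have hVs : V ∈ splitOff π W q := by simp [splitOff, hV, hVW]
      rw [P.eval_eq_of_isInterval hT hπ hV hI,
        P.eval_eq_of_isInterval hT hsplit hVs (hnodes.symm ▸ hI), hnodes,
        ih (hπ.erase V) (Finset.mem_erase.2 ⟨hVW.symm, hW⟩) _
          (by rw [Finset.card_erase_of_mem hV, hk, Nat.add_sub_cancel])]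
      congr 1
      rw [splitOff, splitOff, Finset.erase_insert_of_ne h1.symm,
        Finset.erase_insert_of_ne h2.symm, Finset.erase_right_comm]
    -- The last block is always an interval, so if no block other than `W` is one, then `W` is the
    -- last block.
    · have hI : IsInterval χ (π.sup id) W := by
        have h1 := isInterval_lastBlock hπ ⟨W, hW⟩
        have h2 := lastBlock_mem π ⟨W, hW⟩
        have h3 : lastBlock π ⟨W, hW⟩ = W := by
          by_contra h
          exact hV ⟨_, h2, h, h1⟩
        rwa [h3] at h1
      have h1 : (splitOff π W q).erase {q} = insert (W.erase q) (π.erase W) := by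
        refine Finset.erase_insert fun h => ?_
        rcases Finset.mem_insert.1 h with h | h
        · exact hqW h
        · exact (hVq _ (Finset.mem_of_mem_erase h) (Finset.ne_of_mem_erase h)).1 rfl
      have h2 : (insert (W.erase q) (π.erase W)).erase (W.erase q) = π.erase W := by
        refine Finset.erase_insert fun h => ?_
        exact (hVq _ (Finset.mem_of_mem_erase h) (Finset.ne_of_mem_erase h)).2 rfl
      have hqs : {q} ∈ splitOff π W q := Finset.mem_insert_self _ _
      have h3 : (insert (W.erase q) (π.erase W)).sup id = π.sup id \ {q} := by
        rw [← h1, hsplit.nodes_erase hqs, hnodes]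
      rw [P.eval_eq_of_isInterval hT hπ hW hI,
        P.eval_eq_of_isInterval hT hsplit hqs (isInterval_singleton _ _), h1,
        P.eval_eq_of_isInterval hT (h1 ▸ hsplit.erase {q}) (Finset.mem_insert_self _ _)
          (h3.symm ▸ hI.erase q), h2, h3, hnodes]
      refine P.eval_congr ?_
      rw [hπ.nodes_erase hW]
      exact P.strip_split hT hI (Finset.le_sup (f := id) hW) hb hq hne x

end BBSpace

/-! ### The recursive moments as values of decorated words -/

section Extremal

variable {n : ℕ} {χ : Fin n → Side}

/-- If `D` meets side `s`, the extremal node is the smallest one on that side, which is the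
candidate for a next node. Otherwise `D` lies on the other side and the extremal node is its
largest, the one adjacent to the middle. -/
theorem extremal_spec (s : Side) (D : Finset (Fin n)) (h : D.Nonempty) :
    (χ (extremal χ s D h) = s → ∀ x ∈ D, χ x = s → extremal χ s D h ≤ x) ∧
      (χ (extremal χ s D h) ≠ s → ∀ x ∈ D, χ x ≠ s ∧ x ≤ extremal χ s D h) := by
  cases s
  · have h1 := (D.exists_min_image (chiPos χ) h).choose_spec.2
    change ∀ x ∈ D, chiPos χ (extremal χ Side.left D h) ≤ chiPos χ x at h1
    generalize extremal χ Side.left D h = j at *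
    constructor
    · intro hj x hx hxs
      have := h1 x hx
      simpa [chiPos, hj, hxs] using this
    · intro hj x hx
      have := h1 x hx
      have h2 := x.isLt
      have h3 := j.isLt
      have hx' : χ x ≠ Side.left := by
        intro hxs
        simp only [chiPos, if_neg hj, if_pos hxs] at this
        omega
      simp only [chiPos, if_neg hj, if_neg hx'] at this
      exact ⟨hx', Fin.le_def.2 (by omega)⟩
  · have h1 := (D.exists_max_image (chiPos χ) h).choose_spec.2
    change ∀ x ∈ D, chiPos χ x ≤ chiPos χ (extremal χ Side.right D h) at h1
    generalize extremal χ Side.right D h = j at *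
    constructor
    · intro hj x hx hxs
      have := h1 x hx
      have h2 := x.isLt
      have h3 := j.isLt
      simp only [chiPos, hj, hxs, reduceCtorEq, if_false] at this
      exact Fin.le_def.2 (by omega)
    · intro hj x hx
      have := h1 x hx
      have h2 := x.isLt
      have h3 := j.isLt
      have hj' : χ j = Side.left := by
        cases hs : χ j
        · rfl
        · exact absurd hs hj
      have hx' : χ x = Side.left := by
        cases hs : χ x
        · rfl
        · simp only [chiPos, hj', hs, reduceCtorEq, if_false, if_true] at this
          omega
      simp only [chiPos, hj', hx', if_true] at this
      exact ⟨by simp [hx'], this⟩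

theorem mem_below {π : Finset (Finset (Fin n))} {m j : Fin n} :
    j ∈ below π m ↔ j ∈ π.sup id ∧ m < j := by
  rw [below, Finset.mem_filter]

end Extremal

namespace BBSpace

variable {B A : Type*} [Ring B] [Algebra ℂ B] [Ring A] [Algebra ℂ A] (P : BBSpace B A) {n : ℕ}
  {χ : Fin n → Side} {T : Fin n → A}

theorem momentAux_of_card_le {π : Finset (Finset (Fin n))} (hπ : ∀ V ∈ π, V.Nonempty)
    (T' : Fin n → A) (h : ¬ 1 < π.card) :
    P.momentAux χ π hπ T' = P.E (orderedProd T' (π.sup id)) := by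
  rw [momentAux, dif_neg h]

theorem momentAux_of_below {π : Finset (Finset (Fin n))} (hπ : IsBlocks χ π)
    (T' : Fin n → A) (h : 1 < π.card) (hne : π.Nonempty) {m : Fin n}
    (hm : IsMin (lastBlock π hne) m) (hD : (below (π.erase (lastBlock π hne)) m).Nonempty) :
    ∃ W ∈ π.erase (lastBlock π hne), ∃ j ∈ W, ∃ k ∈ W, m < j ∧ m < k ∧
      (∀ i ∈ W, m < i → k ≤ i) ∧
      (χ j = χ m → ∀ x ∈ below (π.erase (lastBlock π hne)) m, χ x = χ m → j ≤ x) ∧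
      (χ j ≠ χ m → ∀ x ∈ below (π.erase (lastBlock π hne)) m, χ x ≠ χ m ∧ x ≤ j) ∧
      P.momentAux χ π hπ.nonempty T' =
        P.momentAux χ (π.erase (lastBlock π hne)) (hπ.erase _).nonempty
          (Function.update T' k
            (P.op (χ m) (P.E (orderedProd T' (lastBlock π hne))) * T' k)) := by
  have hmin : (lastBlock π hne).min' (hπ.nonempty _ (lastBlock_mem π hne)) = m :=
    IsMin.eq ⟨Finset.min'_mem _ _, fun v hv => Finset.min'_le _ v hv⟩ hm
  subst hmin
  set V := lastBlock π hne with hV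
  set m := V.min' (hπ.nonempty _ (lastBlock_mem π hne))
  have hj := extremal_mem χ (χ m) _ hD
  have hspec := extremal_spec (χ := χ) (χ m) _ hD
  have hk := Finset.min'_mem _ (sameBlock_extremal_nonempty χ (χ m) (π.erase V) m hD)
  have hk' := Finset.min'_le (sameBlock (π.erase V) (below (π.erase V) m)
        (extremal χ (χ m) (below (π.erase V) m) hD))
  obtain ⟨hk1, W, hW, hkW, hjW⟩ := Finset.mem_filter.1 hk
  refine ⟨W, hW, _, hjW, _, hkW, (mem_below.1 hj).2, (mem_below.1 hk1).2, ?_, hspec.1, hspec.2,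
    ?_⟩
  · intro i hi hmi
    exact hk' i
      (Finset.mem_filter.2 ⟨mem_below.2 ⟨mem_nodes.2 ⟨W, hW, hi⟩, hmi⟩, W, hW, hi, hjW⟩)
  · rw [momentAux, dif_pos h, dif_pos hD]

theorem momentAux_of_not_below {π : Finset (Finset (Fin n))} (hπ : IsBlocks χ π)
    (T' : Fin n → A) (h : 1 < π.card) (hne : π.Nonempty) {m : Fin n}
    (hm : IsMin (lastBlock π hne) m) (hD : ¬ (below (π.erase (lastBlock π hne)) m).Nonempty) :
    ∃ k ∈ (π.erase (lastBlock π hne)).sup id,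
      (∀ i ∈ (π.erase (lastBlock π hne)).sup id, i ≤ k) ∧
      P.momentAux χ π hπ.nonempty T' =
        P.momentAux χ (π.erase (lastBlock π hne)) (hπ.erase _).nonempty
          (Function.update T' k
            (T' k * P.op (χ m) (P.E (orderedProd T' (lastBlock π hne))))) := by
  have hmin : (lastBlock π hne).min' (hπ.nonempty _ (lastBlock_mem π hne)) = m :=
    IsMin.eq ⟨Finset.min'_mem _ _, fun v hv => Finset.min'_le _ v hv⟩ hm
  subst hmin
  refine ⟨_, Finset.max'_mem _ (sup_erase_nonempty π hπ.nonempty h (lastBlock π hne)),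
    fun i hi => Finset.le_max' _ i hi, ?_⟩
  rw [momentAux, dif_pos h, dif_neg hD]

variable (χ T) in
/-- The entries `T'` represent the word decorated by `d` and `e`: from the node `t` on, the blocks
have the same products, where `e` is attached to the end of the block of the last node `K`. -/
structure Represents (π : Finset (Finset (Fin n))) (T' : Fin n → A) (d : Fin n → B) (e : B)
    (t K : Fin n) : Prop where
  mem : K ∈ π.sup id
  le : ∀ j ∈ π.sup id, j ≤ K
  min_le : ∀ U ∈ π, ∃ u ∈ U, u ≤ t
  before : ∀ j ∈ π.sup id, j < t → T' j = P.decorate χ T d j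
  inner : ∀ W ∈ π, K ∉ W →
    orderedProd T' (W.filter (t ≤ ·)) = orderedProd (P.decorate χ T d) (W.filter (t ≤ ·))
  last : ∀ W ∈ π, K ∈ W → ∀ z, P.E (z * orderedProd T' (W.filter (t ≤ ·))) =
    P.E (z * orderedProd (P.decorate χ T d) (W.filter (t ≤ ·)) * P.L e)

namespace Represents

variable {P} {π : Finset (Finset (Fin n))} {T' : Fin n → A} {d : Fin n → B} {e : B} {t K : Fin n}

theorem prod_before (h : P.Represents χ T π T' d e t K) {W : Finset (Fin n)} (hW : W ∈ π)
    {W' : Finset (Fin n)} (hW' : W' ⊆ W) :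
    orderedProd T' (W'.filter (· < t)) = orderedProd (P.decorate χ T d) (W'.filter (· < t)) :=
  orderedProd_congr fun k hk => h.before k
    (mem_nodes.2 ⟨W, hW, hW' (Finset.mem_filter.1 hk).1⟩) (Finset.mem_filter.1 hk).2

theorem filter_eq {W W' : Finset (Fin n)} {t : Fin n} (hW' : W' ⊆ W)
    (h : W.filter (t ≤ ·) ⊆ W') : W'.filter (t ≤ ·) = W.filter (t ≤ ·) := by
  ext i
  simp only [Finset.mem_filter]
  exact ⟨fun hi => ⟨hW' hi.1, hi.2⟩, fun hi => ⟨h (Finset.mem_filter.2 hi), hi.2⟩⟩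

theorem inner_of (h : P.Represents χ T π T' d e t K) {W : Finset (Fin n)} (hW : W ∈ π)
    (hK : K ∉ W) {W' : Finset (Fin n)} (hW' : W' ⊆ W) (hle : W.filter (t ≤ ·) ⊆ W') :
    orderedProd T' W' = orderedProd (P.decorate χ T d) W' := by
  rw [orderedProd_split _ W' t, h.prod_before hW hW', filter_eq hW' hle, h.inner W hW hK,
    orderedProd_split (P.decorate χ T d) W' t, filter_eq hW' hle]

theorem last_of (h : P.Represents χ T π T' d e t K) {W : Finset (Fin n)} (hW : W ∈ π)
    (hK : K ∈ W) {W' : Finset (Fin n)} (hW' : W' ⊆ W) (hle : W.filter (t ≤ ·) ⊆ W') (z : A) :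
    P.E (z * orderedProd T' W') = P.E (z * orderedProd (P.decorate χ T d) W' * P.L e) := by
  rw [orderedProd_split _ W' t, h.prod_before hW hW', filter_eq hW' hle, ← mul_assoc,
    h.last W hW hK, orderedProd_split (P.decorate χ T d) W' t, filter_eq hW' hle, mul_assoc z]

theorem E_orderedProd (h : P.Represents χ T π T' d e t K) {V : Finset (Fin n)} (hV : V ∈ π) :
    P.E (orderedProd T' V) = P.blockVal χ T V d (if K ∈ V then e else 1) := by
  split_ifs with hK
  · have := h.last_of hV hK subset_rfl (Finset.filter_subset _ _) 1
    rwa [one_mul, one_mul] at this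
  · rw [h.inner_of hV hK subset_rfl (Finset.filter_subset _ _), blockVal, P.L_one, mul_one]

end Represents

/-- The recursion may insert its factor at another node than stripping does, so entries cannot be
compared one by one. The invariant compares only block products from `t` on, and, for the block
ending at `K`, only under `E`, where `L` and `R` are interchangeable. As the minima of the removed
blocks never exceed `t`, these tails only grow or become single nodes. -/
theorem momentAux_eq_eval (hT : ∀ k, T k ∈ P.face (χ k)) {π : Finset (Finset (Fin n))}
    (hπ : IsBlocks χ π) {T' : Fin n → A} {d : Fin n → B} {e : B} {t K : Fin n}
    (h : P.Represents χ T π T' d e t K) :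
    P.momentAux χ π hπ.nonempty T' = P.eval χ T π (d, e) := by
  induction hk : π.card generalizing π T' d e t K with
  | zero =>
    obtain rfl := Finset.card_eq_zero.1 hk
    simpa using h.mem
  | succ N ih =>
    have hne : π.Nonempty := Finset.card_pos.1 (by omega)
    have hV := lastBlock_mem π hne
    have hI := isInterval_lastBlock hπ hne
    have hcard : (π.erase (lastBlock π hne)).card = N := by
      rw [Finset.card_erase_of_mem hV, hk, Nat.add_sub_cancel]
    obtain ⟨m, hm⟩ := exists_isMin (hπ.nonempty _ hV)
    have hnodes := hπ.nodes_erase hV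
    rw [P.eval_eq hne]
    by_cases h1 : 1 < π.card
    · have hmt : m ≤ t := by
        obtain ⟨u, hu, hut⟩ := h.min_le _ hV
        exact (hm.2 u hu).trans hut
      have hminle : ∀ U ∈ π.erase (lastBlock π hne), ∃ u ∈ U, u ≤ m := fun U hU => by
        have hU' := Finset.mem_of_mem_erase hU
        obtain ⟨u, hu⟩ := exists_isMin (hπ.nonempty U hU')
        exact ⟨u, hu.1, lastBlock_spec π hne hU' hm hu⟩
      have hval := h.E_orderedProd hV
      by_cases hD : (below (π.erase (lastBlock π hne)) m).Nonempty
      · obtain ⟨W, hW, j, hjW, k, hkW, hmj, hmk, hkle, hj1, hj2, hmom⟩ :=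
          P.momentAux_of_below hπ T' h1 hne hm hD
        rw [hmom]
        have hW' := Finset.mem_erase.1 hW
        generalize lastBlock π hne = V at *
        have hWV : ∀ i ∈ W, i ∉ V := fun i hi hi' => hW'.1 (hπ.disjoint W hW'.2 V hV i hi hi')
        have hUW : ∀ U ∈ π.erase V, U ≠ W → ∀ i ∈ W, i ∉ U := fun U hU hne i hi hi' =>
          hne (hπ.disjoint U (Finset.mem_of_mem_erase hU) W hW'.2 i hi' hi)
        have hUk : ∀ U ∈ π.erase V, U ≠ W → ∀ i ∈ U.filter (m ≤ ·), i ≠ k :=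
          fun U hU hUW' i hi e => hUW U hU hUW' k hkW (e ▸ (Finset.mem_filter.1 hi).1)
        have hUV : ∀ U ∈ π.erase V, ∀ i ∈ U, i ∉ V := fun U hU i hi hi' =>
          (Finset.ne_of_mem_erase hU)
            (hπ.disjoint U (Finset.mem_of_mem_erase hU) V hV i hi hi')
        have hSU : ∀ U ∈ π, ∀ i ∈ U, i ∈ π.sup id := fun U hU i hi => mem_nodes.2 ⟨U, hU, hi⟩
        have hjS : j ∈ (π.erase V).sup id := mem_nodes.2 ⟨W, hW, hjW⟩
        have hsub : ∀ U : Finset (Fin n), U.filter (t ≤ ·) ⊆ U.filter (m ≤ ·) := fun U i hi => by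
          rw [Finset.mem_filter] at hi ⊢
          exact ⟨hi.1, hmt.trans hi.2⟩
        have hprod : orderedProd (Function.update T' k
            (P.op (χ m) (P.E (orderedProd T' V)) * T' k)) (W.filter (m ≤ ·)) =
            P.op (χ m) (P.E (orderedProd T' V)) * orderedProd T' (W.filter (m ≤ ·)) := by
          refine orderedProd_update_mul (Finset.mem_filter.2 ⟨hkW, hmk.le⟩) fun i hi hik => ?_
          have hi := Finset.mem_filter.1 hi
          have hmi : m < i := lt_of_le_of_ne hi.2 fun e => hWV i hi.1 (e ▸ hm.1)
          exact absurd (hkle i hi.1 hmi) (not_le.2 hik)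
        have hWbelow : ∀ i ∈ W.filter (m ≤ ·), i ∈ below (π.erase V) m := fun i hi => by
          have hi := Finset.mem_filter.1 hi
          exact mem_below.2 ⟨mem_nodes.2 ⟨W, hW, hi.1⟩,
            lt_of_le_of_ne hi.2 fun e => hWV i hi.1 (e ▸ hm.1)⟩
        have hother : ∀ U ∈ π.erase V, U ≠ W → K ∉ U →
            orderedProd (Function.update T' k
              (P.op (χ m) (P.E (orderedProd T' V)) * T' k)) (U.filter (m ≤ ·)) =
            orderedProd (P.decorate χ T d) (U.filter (m ≤ ·)) := fun U hU hUW' hKU => by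
          rw [← h.inner_of (Finset.mem_of_mem_erase hU) hKU (Finset.filter_subset _ _) (hsub U)]
          exact orderedProd_congr fun i hi => Function.update_of_ne (hUk U hU hUW' i hi) _ _
        have hbefore : ∀ i ∈ (π.erase V).sup id, i < m → Function.update T' k
            (P.op (χ m) (P.E (orderedProd T' V)) * T' k) i = P.decorate χ T d i :=
          fun i hi him => by
            rw [Function.update_of_ne (him.trans hmk).ne]
            exact h.before i (Finset.mem_sdiff.1 (hnodes ▸ hi)).1 (him.trans_le hmt)
        -- If `j` is on the side of `m`, it is the next node. The recursion multiplies at `k`, the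
        -- first node of `W` after `m`; the nodes from `k` up to `j` are on the other side, so both
        -- insertions give the same tail of `W`.
        by_cases hjm : χ j = χ m
        · have hnext : IsNext χ (π.sup id) V j := by
            refine ⟨hSU W hW'.2 j hjW, hWV j hjW, m, hm, hjm, hmj, fun x hx hxV hxm hmx => ?_⟩
            exact hj1 hjm x (mem_below.2 ⟨hnodes ▸ Finset.mem_sdiff.2 ⟨hx, hxV⟩, hmx⟩) hxm
          have hKV : K ∉ V := fun hK =>
            absurd (h.le j (hSU W hW'.2 j hjW)) (not_le.2 (hnext.forall_lt hI K hK).2)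
          rw [if_neg hKV] at hval
          rw [P.strip_of_isNext hnext, ← hval]
          have hprod' : orderedProd (P.decorate χ T (Function.update d j
              (mulS (χ j) (P.E (orderedProd T' V)) (d j)))) (W.filter (m ≤ ·)) =
              P.op (χ m) (P.E (orderedProd T' V)) *
                orderedProd (P.decorate χ T d) (W.filter (m ≤ ·)) := by
            rw [decorate_update, orderedProd_update_mul (Finset.mem_filter.2 ⟨hjW, hmj.le⟩), hjm]
            intro i hi hij
            refine P.commute_op_decorate hT (fun e => ?_) _ _
            exact absurd (hj1 hjm i (hWbelow i hi) (e.symm.trans hjm)) (not_le.2 hij)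
          have hdec : ∀ i, i ≠ j → P.decorate χ T (Function.update d j
              (mulS (χ j) (P.E (orderedProd T' V)) (d j))) i = P.decorate χ T d i :=
            fun i hi => by rw [decorate_update, Function.update_of_ne hi]
          refine ih (hπ.erase V) (t := m) (K := K) ⟨?_, ?_, hminle, ?_, ?_, ?_⟩ hcard
          · rw [hnodes]; exact Finset.mem_sdiff.2 ⟨h.mem, hKV⟩
          · intro i hi
            rw [hnodes] at hi
            exact h.le i (Finset.mem_sdiff.1 hi).1
          · intro i hi him
            rw [hbefore i hi him, hdec i (him.trans hmj).ne]
          · intro U hU hKU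
            by_cases hUW' : U = W
            · subst hUW'
              rw [hprod, hprod', h.inner_of hW'.2 hKU (Finset.filter_subset _ _) (hsub U)]
            · rw [hother U hU hUW' hKU]
              exact orderedProd_congr fun i hi => (hdec i fun e =>
                hUW U hU hUW' j hjW (e ▸ (Finset.mem_filter.1 hi).1)).symm
          · intro U hU hKU z
            by_cases hUW' : U = W
            · subst hUW'
              rw [hprod, hprod', ← mul_assoc,
                h.last_of hW'.2 hKU (Finset.filter_subset _ _) (hsub U)]
              simp only [mul_assoc]
            · rw [orderedProd_congr (T' := T') fun i hi => Function.update_of_ne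
                  (hUk U hU hUW' i hi) _ _,
                h.last_of (Finset.mem_of_mem_erase hU) hKU (Finset.filter_subset _ _) (hsub U),
                orderedProd_congr fun i hi => (hdec i fun e =>
                  hUW U hU hUW' j hjW (e ▸ (Finset.mem_filter.1 hi).1)).symm]
        -- Otherwise all remaining nodes after `m` are on the other side. The factor passes to the
        -- end of `W`, so `j` becomes the last node and the value joins the middle element.
        · have hj2 := hj2 hjm
          have hno : ∀ p, ¬ IsNext χ (π.sup id) V p := by
            rintro p ⟨hpS, hpV, m1, hm1, hpm, hlt, -⟩
            obtain rfl := hm.eq hm1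
            exact (hj2 p (mem_below.2 ⟨hnodes ▸ Finset.mem_sdiff.2 ⟨hpS, hpV⟩, hlt⟩)).1 hpm
          have hjmax : ∀ i ∈ (π.erase V).sup id, i ≤ j := by
            intro i hi
            rcases le_or_gt i m with him | him
            · exact him.trans hmj.le
            · exact (hj2 i (mem_below.2 ⟨hi, him⟩)).2
          have hKj : K ∉ V → K = j := fun hK =>
            le_antisymm (hjmax K (hnodes ▸ Finset.mem_sdiff.2 ⟨h.mem, hK⟩))
              (h.le j (hSU W hW'.2 j hjW))
          have hcomm : Commute (P.op (χ m) (P.E (orderedProd T' V)))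
              (orderedProd (P.decorate χ T d) (W.filter (m ≤ ·))) :=
            commute_orderedProd fun i hi =>
              P.commute_op_decorate hT (hj2 i (hWbelow i hi)).1.symm _ _
          rw [P.strip_of_not_isNext hno]
          refine ih (hπ.erase V) (t := m) (K := j) ⟨hjS, hjmax, hminle, hbefore, ?_, ?_⟩ hcard
          · intro U hU hjU
            refine hother U hU (fun e => hjU (e ▸ hjW)) fun hKU => ?_
            exact hjU (hKj (hUV U hU K hKU) ▸ hKU)
          · intro U hU hjU z
            have hUW' : U = W := by
              by_contra hne
              exact hUW U hU hne j hjW hjU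
            subst hUW'
            rw [hprod]
            by_cases hKV : K ∈ V
            · rw [if_pos hKV] at hval
              rw [h.inner_of hW'.2 (fun hK => hWV K hK hKV) (Finset.filter_subset _ _) (hsub U),
                hcomm.eq, ← mul_assoc, E_mul_op, hval]
            · rw [if_neg hKV] at hval
              have hKU : K ∈ U := by rwa [hKj hKV]
              rw [← mul_assoc, h.last_of hW'.2 hKU (Finset.filter_subset _ _) (hsub U),
                mul_assoc z, hcomm.eq, ← mul_assoc, E_mul_op_mul_L, hval,
                ← P.blockVal_of_side hT]
              -- The last node `K = j` is outside `V`, so a node of `V` on the side of `j` would put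
              -- `K` into `V` by the interval property. Hence `V` is one-sided.
              intro v hv
              by_contra hvm
              refine hKV (hI.opposite v hv m hm.1 K h.mem ?_ ?_
                (lt_of_le_of_ne (h.le v (hSU V hV v hv)) fun e => hKV (e ▸ hv)))
              · rw [hKj hKV]
                revert hvm hjm
                cases χ v <;> cases χ m <;> cases χ j <;> simp
              · rw [hKj hKV]
                exact fun e => hjm e.symm
      · obtain ⟨k, hkS, hkmax, hmom⟩ := P.momentAux_of_not_below hπ T' h1 hne hm hD
        rw [hmom]
        generalize lastBlock π hne = V at *
        have hkS' := Finset.mem_sdiff.1 (hnodes ▸ hkS)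
        have hlt : ∀ i ∈ (π.erase V).sup id, i < m := by
          intro i hi
          have h2 := Finset.mem_sdiff.1 (hnodes ▸ hi)
          refine lt_of_le_of_ne (not_lt.1 fun h3 => hD ⟨i, mem_below.2 ⟨hi, h3⟩⟩) fun e => ?_
          exact h2.2 (e ▸ hm.1)
        have hKV : K ∈ V := by
          by_contra hK
          exact absurd (hlt K (hnodes ▸ Finset.mem_sdiff.2 ⟨h.mem, hK⟩))
            (not_lt.2 (h.le m (mem_nodes.2 ⟨V, hV, hm.1⟩)))
        have hno : ∀ p, ¬ IsNext χ (π.sup id) V p := by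
          rintro p ⟨hpS, hpV, m1, hm1, hpm, hlt', -⟩
          obtain rfl := hm.eq hm1
          exact (hlt p (hnodes ▸ Finset.mem_sdiff.2 ⟨hpS, hpV⟩)).not_gt hlt'
        rw [if_pos hKV] at hval
        rw [P.strip_of_not_isNext hno]
        have hT'k : ∀ i ∈ (π.erase V).sup id, T' i = P.decorate χ T d i := fun i hi =>
          h.before i (Finset.mem_sdiff.1 (hnodes ▸ hi)).1 ((hlt i hi).trans_le hmt)
        have hUk : ∀ U ∈ π.erase V, ∀ i ∈ U.filter (k ≤ ·), i = k := fun U hU i hi =>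
          le_antisymm (hkmax i (mem_nodes.2 ⟨U, hU, (Finset.mem_filter.1 hi).1⟩))
            (Finset.mem_filter.1 hi).2
        -- All remaining nodes precede `m`, so their entries are still untouched. Only `k`, the new
        -- last node, receives the factor, and the tail from `k` on is a single entry.
        refine ih (hπ.erase V) (t := k) (K := k) ⟨hkS, hkmax, ?_, ?_, ?_, ?_⟩ hcard
        · intro U hU
          obtain ⟨u, hu⟩ := (hπ.erase V).nonempty U hU
          exact ⟨u, hu, hkmax u (mem_nodes.2 ⟨U, hU, hu⟩)⟩
        · intro i hi hik
          rw [Function.update_of_ne hik.ne, hT'k i hi]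
        · intro U hU hkU
          refine orderedProd_congr fun i hi => ?_
          exact absurd (hUk U hU i hi ▸ (Finset.mem_filter.1 hi).1) hkU
        · intro U hU hkU z
          have hfil : U.filter (k ≤ ·) = {k} := by
            refine Finset.eq_singleton_iff_unique_mem.2 ⟨?_, hUk U hU⟩
            exact Finset.mem_filter.2 ⟨hkU, le_rfl⟩
          rw [hfil, orderedProd_singleton, orderedProd_singleton, Function.update_self,
            ← mul_assoc, E_mul_op, hT'k k hkS, hval]
    · have hN : N = 0 := by omega
      have hempty : π.erase (lastBlock π hne) = ∅ := Finset.card_eq_zero.1 (hcard.trans hN)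
      have hsup : π.sup id = lastBlock π hne := by
        conv_lhs => rw [← Finset.insert_erase hV, hempty]
        simp
      have hno : ∀ p, ¬ IsNext χ (π.sup id) (lastBlock π hne) p := fun p hp =>
        hp.2.1 (hsup ▸ hp.1)
      rw [P.momentAux_of_card_le _ _ h1, hempty, eval_empty, P.strip_of_not_isNext hno,
        hsup, h.E_orderedProd hV, if_pos (hsup ▸ h.mem)]

end BBSpace

/-! ### Splitting a node off a bi-non-crossing partition -/

section SplitBNC

variable {n : ℕ} {χ : Fin n → Side}

theorem BNC.isBlocks (π : BNC χ) : IsBlocks χ π.1.parts where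
  nonempty _ hV := π.1.nonempty_of_mem_parts hV
  disjoint _ hU _ hV _ hi hi' := π.1.eq_of_mem_parts hU hV hi hi'
  nonCrossing := π.2

/-- The partition `{{q}, {q}ᶜ}`. -/
def isolate (hn : 2 ≤ n) (q : Fin n) : Finpartition (Finset.univ : Finset (Fin n)) :=
  (Finpartition.indiscrete (a := ({q}ᶜ : Finset (Fin n))) (by
    rw [Finset.bot_eq_empty, ← Finset.nonempty_iff_ne_empty, ← Finset.card_pos,
      Finset.card_compl, Fintype.card_fin, Finset.card_singleton]
    omega)).extend (b := {q}) (Finset.singleton_ne_empty q) disjoint_compl_left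
      (by simp)

theorem mem_inf_isolate (hn : 2 ≤ n) (q : Fin n)
    (π : Finpartition (Finset.univ : Finset (Fin n))) (V : Finset (Fin n)) :
    V ∈ (π ⊓ isolate hn q).parts ↔ V.Nonempty ∧ ∃ U ∈ π.parts, V = U ∩ {q} ∨ V = U.erase q := by
  simp only [Finpartition.parts_inf, isolate, Finpartition.extend_parts,
    Finpartition.indiscrete_parts, Finset.mem_erase, Finset.mem_image, Finset.mem_product,
    Prod.exists, Finset.mem_insert, Finset.mem_singleton, Finset.bot_eq_empty,
    ← Finset.nonempty_iff_ne_empty, Finset.inf_eq_inter]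
  refine and_congr_right fun _ => ⟨?_, ?_⟩
  · rintro ⟨U, W, ⟨hU, rfl | rfl⟩, rfl⟩
    · exact ⟨U, hU, Or.inl rfl⟩
    · exact ⟨U, hU, Or.inr (by ext; simp [and_comm])⟩
  · rintro ⟨U, hU, rfl | rfl⟩
    · exact ⟨U, _, ⟨hU, Or.inl rfl⟩, rfl⟩
    · exact ⟨U, _, ⟨hU, Or.inr rfl⟩, by ext; simp [and_comm]⟩

theorem parts_inf_isolate (hn : 2 ≤ n) {q : Fin n}
    {π : Finpartition (Finset.univ : Finset (Fin n))} {W : Finset (Fin n)} (hW : W ∈ π.parts)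
    (hq : q ∈ W) (hne : (W.erase q).Nonempty) :
    (π ⊓ isolate hn q).parts = splitOff π.parts W q := by
  ext V
  rw [mem_inf_isolate, splitOff, Finset.mem_insert, Finset.mem_insert, Finset.mem_erase]
  have hU : ∀ U ∈ π.parts, U ≠ W → q ∉ U := fun U hU hUW hqU =>
    hUW (π.eq_of_mem_parts hU hW hqU hq)
  constructor
  · rintro ⟨hV, U, hUπ, rfl | rfl⟩ <;> by_cases hUW : U = W
    · subst hUW
      exact Or.inl (Finset.inter_singleton_of_mem hq)
    · rw [Finset.inter_singleton_of_notMem (hU U hUπ hUW)] at hV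
      simp at hV
    · subst hUW
      exact Or.inr (Or.inl rfl)
    · rw [Finset.erase_eq_of_notMem (hU U hUπ hUW)]
      exact Or.inr (Or.inr ⟨hUW, hUπ⟩)
  · rintro (rfl | rfl | ⟨hVW, hV⟩)
    · exact ⟨Finset.singleton_nonempty q, W, hW, Or.inl (Finset.inter_singleton_of_mem hq).symm⟩
    · exact ⟨hne, W, hW, Or.inr rfl⟩
    · exact ⟨π.nonempty_of_mem_parts hV, V, hV,
        Or.inr (Finset.erase_eq_of_notMem (hU V hV hVW)).symm⟩

theorem inf_isolate_of_singleton (hn : 2 ≤ n) {q : Fin n}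
    {π : Finpartition (Finset.univ : Finset (Fin n))} (hq : {q} ∈ π.parts) :
    π ⊓ isolate hn q = π := by
  refine inf_eq_left.2 fun U hU => ?_
  by_cases hqU : q ∈ U
  · obtain rfl := π.eq_of_mem_parts hU hq hqU (Finset.mem_singleton_self q)
    exact ⟨{q}, by simp [isolate], le_rfl⟩
  · refine ⟨{q}ᶜ, by simp [isolate], fun i hi => ?_⟩
    rw [Finset.mem_compl, Finset.mem_singleton]
    exact fun e => hqU (e ▸ hi)

theorem splitOff_or_singleton (π : Finpartition (Finset.univ : Finset (Fin n))) (q : Fin n) :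
    {q} ∈ π.parts ∨ ∃ W ∈ π.parts, q ∈ W ∧ (W.erase q).Nonempty := by
  obtain ⟨W, hW, hq⟩ := π.exists_mem (Finset.mem_univ q)
  rcases (W.erase q).eq_empty_or_nonempty with h | h
  · rw [Finset.erase_eq_empty_iff] at h
    rcases h with rfl | rfl
    · simp at hq
    · exact Or.inl hW
  · exact Or.inr ⟨W, hW, hq, h⟩

/-- The bi-non-crossing partition obtained from `π` by making `q` a block of its own. -/
def BNC.isolate (hn : 2 ≤ n) (q : Fin n) (π : BNC χ) : BNC χ :=
  ⟨π.1 ⊓ BiFree.isolate hn q, by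
    rcases splitOff_or_singleton π.1 q with h | ⟨W, hW, hq, hne⟩
    · rw [inf_isolate_of_singleton hn h]
      exact π.2
    · intro U hU V hV
      rw [parts_inf_isolate hn hW hq hne] at hU hV
      exact (π.isBlocks.splitOff hW hq hne).nonCrossing U hU V hV⟩

/-- This is the meet property needed for the Weisner argument, stated with a condition on partitions
so that `{{q}, {q}ᶜ}` need not be treated as an element of `BNC χ`. -/
theorem BNC.le_isolate_iff (hn : 2 ≤ n) (q : Fin n) (σ τ : BNC χ) :
    σ ≤ τ.isolate hn q ↔ σ ≤ τ ∧ σ.1 ≤ BiFree.isolate hn q := by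
  change σ.1 ≤ τ.1 ⊓ BiFree.isolate hn q ↔ σ.1 ≤ τ.1 ∧ σ.1 ≤ BiFree.isolate hn q
  exact le_inf_iff

theorem not_one_le_isolate (hn : 2 ≤ n) (q : Fin n) :
    ¬ (BNC.one χ).1 ≤ BiFree.isolate hn q := by
  intro h
  have : (Finset.univ : Finset (Fin n)) ∈ (BNC.one χ).1.parts := by
    obtain ⟨V, hV, -⟩ := (⊤ : Finpartition (Finset.univ : Finset (Fin n))).exists_mem
      (Finset.mem_univ q)
    have hV' := Finpartition.parts_top_subset _ hV
    rw [Finset.mem_singleton] at hV'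
    rw [hV'] at hV
    exact hV
  obtain ⟨c, hc, hle⟩ := h this
  have hc' : c = Finset.univ := Finset.univ_subset_iff.1 hle
  simp only [BiFree.isolate, Finpartition.extend_parts, Finpartition.indiscrete_parts,
    Finset.mem_insert, Finset.mem_singleton] at hc
  rcases hc with rfl | rfl
  · have := congrArg Finset.card hc'
    simp at this
    omega
  · have := congrArg (q ∈ ·) hc'
    simp at this

end SplitBNC

/-! ### Moments when a node is isolated -/

namespace BBSpace

variable {B A : Type*} [Ring B] [Algebra ℂ B] [Ring A] [Algebra ℂ A] (P : BBSpace B A) {n : ℕ}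
  {χ : Fin n → Side}

theorem eq_op_of {x : A} {b : B} (s : Side) (hleft : s = Side.left → x = P.L b)
    (hright : s = Side.right → x = P.R b) : x = P.op s b := by
  cases s
  · exact hleft rfl
  · exact hright rfl

theorem moment_eq_eval (q : Fin n) (π : BNC χ) (T : ∀ k, P.face (χ k)) :
    P.moment χ π T = P.eval χ (fun k => (T k : A)) π.1.parts (fun _ => 1, 1) := by
  have hmem : ∀ j, j ∈ π.1.parts.sup id := fun j =>
    mem_nodes.2 (π.1.exists_mem (Finset.mem_univ j))
  have hne : (Finset.univ : Finset (Fin n)).Nonempty := ⟨q, Finset.mem_univ q⟩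
  have hle : ∀ j, j ≤ Finset.univ.max' hne := fun j => Finset.le_max' _ j (Finset.mem_univ j)
  have hdec : P.decorate χ (fun k => (T k : A)) (fun _ => 1) = fun k => (T k : A) := by
    funext k
    rw [decorate, op_one, one_mul]
  -- With trivial decorations the word represents itself; `t` and `K` both start at the largest
  -- node.
  refine P.momentAux_eq_eval (fun k => (T k).2) π.isBlocks (t := Finset.univ.max' hne)
    (K := Finset.univ.max' hne) ⟨hmem _, fun j _ => hle j, ?_, ?_, ?_, ?_⟩
  · intro U hU
    obtain ⟨u, hu⟩ := π.1.nonempty_of_mem_parts hU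
    exact ⟨u, hu, hle u⟩
  · intro j _ _
    rw [hdec]
  · intro W _ _
    rw [hdec]
  · intro W _ _ z
    rw [hdec, P.L_one, mul_one]

theorem moment_isolate (hn : 2 ≤ n) {q : Fin n} {b : B} {T : ∀ k, P.face (χ k)}
    (hb : (T q : A) = P.op (χ q) b) (π : BNC χ) :
    P.moment χ (π.isolate hn q) T = P.moment χ π T := by
  rcases splitOff_or_singleton π.1 q with h | ⟨W, hW, hq, hne⟩
  · congr 1
    exact Subtype.ext (inf_isolate_of_singleton hn h)
  · rw [P.moment_eq_eval q, P.moment_eq_eval q π,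
      P.eval_splitOff (T := fun k => (T k : A)) (fun k => (T k).2) π.isBlocks hW hb hq hne]
    congr 1
    exact parts_inf_isolate hn hW hq hne

end BBSpace

end BiFree

/-! ### Vanishing of the cumulant -/

theorem mainTheorem7 {B A : Type*} [Ring B] [Algebra ℂ B] [Ring A] [Algebra ℂ A]
    (P : BiFree.BBSpace B A) (n : ℕ) (hn : 2 ≤ n) (χ : Fin n → BiFree.Side)
    (T : ∀ k, P.face (χ k)) (q : Fin n) (b : B)
    (hleft : χ q = BiFree.Side.left → (T q : A) = P.L b)
    (hright : χ q = BiFree.Side.right → (T q : A) = P.R b) :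
    P.cumulant χ (BiFree.BNC.one χ) T = 0 := by
  classical
  have hb : (T q : A) = P.op (χ q) b := P.eq_op_of (χ q) hleft hright
  have htop : ∀ σ : BiFree.BNC χ, σ ≤ BiFree.BNC.one χ := fun σ => le_top (a := σ.1)
  rw [BiFree.BBSpace.cumulant, Finset.filter_true_of_mem fun σ _ => htop σ,
    ← Finset.sum_fiberwise Finset.univ fun σ : BiFree.BNC χ => σ.isolate hn q]
  refine Finset.sum_eq_zero fun x _ => ?_
  have h1 := BiFree.sum_mu_fiber_eq_zero (fun σ : BiFree.BNC χ => σ.isolate hn q)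
    (BiFree.BNC.one χ) (fun σ => σ.1 ≤ BiFree.isolate hn q)
    (fun σ τ => BiFree.BNC.le_isolate_iff hn q σ τ) htop (BiFree.not_one_le_isolate hn q) x
  -- On the fibre over `x` every moment equals that of `x`, so it factors out of the Möbius sum.
  rw [Finset.sum_congr rfl (g := fun σ => BiFree.mobius χ σ (BiFree.BNC.one χ) • P.moment χ x T)
    fun σ hσ => ?_, ← Finset.sum_smul]
  · unfold BiFree.mobius
    rw [h1, zero_smul]
  · rw [← P.moment_isolate hn hb σ, (Finset.mem_filter.1 hσ).2]
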